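/- Let $k$ be a commutative ring with $\mathbb{Q}\subset k$, $A$ a commutative $k$-algebra, and $R$ a $k$-algebra over $A$, i.e. a not necessarily commutative $k$-algebra with a $k$-algebra map $\iota:A\to R$. Write $\mathbf{s}=(s_1,\dots,s_p)$. A co-ideal $\Delta\subset\mathbb{N}^p$ is a subset closed under passing to componentwise smaller elements; for an abelian group $M$ and $\Delta\neq\emptyset$, let $M[[\mathbf{s}]]_\Delta=M[[\mathbf{s}]]/\{\sum_\alpha m_\alpha\mathbf{s}^\alpha : m_\alpha=0\ \forall\alpha\in\Delta\}$, and let $M[[\mathbf{s}]]_{\Delta,+}$ be the subgroup of series with zero constant term. Let $\mathcal{U}^p(S;\Delta)$ be the group of units of $S[[\mathbf{s}]]_\Delta$ with constant term $1$ ($S$ a ring), $r^*$ the inverse of $r$, $\chi(\sum r_\alpha\mathbf{s}^\alpha)=\sum|\alpha|r_\alpha\mathbf{s}^\alpha$ and $\varepsilon(r)=r^*\chi(r)$. Let $\mathrm{HS}^p_k(A;\Delta)\subset\mathcal{U}^p(\mathrm{End}_k(A);\Delta)$ be the subgroup of the $D=\sum_{\alpha\in\Delta} D_\alpha\mathbf{s}^\alpha$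 with $D_0=\mathrm{Id}$ and $D_\alpha(xy)=\sum_{\beta+\gamma=\alpha}D_\beta(x)D_\gamma(y)$ for all $\alpha\in\Delta$, $x,y\in A$; for such $D$ one has $\varepsilon(D)\in\mathrm{Der}_k(A)[[\mathbf{s}]]_{\Delta,+}$. A substitution map $\varphi:A[[\mathbf{s}]]_\Delta\to A[[\mathbf{t}]]_\Omega$ ($\Delta\subset\mathbb{N}^p$, $\Omega\subset\mathbb{N}^q$ non-empty co-ideals) is an $A$-algebra map such that every $\varphi(s_i)$ has zero constant term; put $\varphi\bullet r=\sum_\alpha\varphi(\mathbf{s}^\alpha)r_\alpha$. This operation maps $\mathcal{U}^p(R;\Delta)$ to $\mathcal{U}^q(R;\Omega)$ and $\mathrm{HS}^p_k(A;\Delta)$ to $\mathrm{HS}^q_k(A;\Omega)$. An HS-structure $\Psi$ on $R$ over $A/k$ is a family of group homomorphisms $\Psi^p_\Delta:\mathrm{HS}^p_k(A;\Delta)\to\mathcal{U}^p(R;\Delta)$, for all $p\in\mathbb{N}$ and all non-empty co-ideals $\Delta\subset\mathbb{N}^p$, such that (i) $\Psi^p_\Delta(D)\,a=\widetilde{D}(a)\,\Psi^p_\Delta(D)$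 for all $D\in\mathrm{HS}^p_k(A;\Delta)$ and $a\in A[[\mathbf{s}]]_\Delta$, where $\widetilde{D}(\sum_\gamma a_\gamma\mathbf{s}^\gamma)=\sum_\alpha\big(\sum_{\beta+\gamma=\alpha}D_\beta(a_\gamma)\big)\mathbf{s}^\alpha$, and (ii) $\Psi^q_\Omega(\varphi\bullet D)=\varphi\bullet\Psi^p_\Delta(D)$ for all substitution maps $\varphi:A[[\mathbf{s}]]_\Delta\to A[[\mathbf{t}]]_\Omega$ and all $D\in\mathrm{HS}^p_k(A;\Delta)$. Let $\nabla:\mathrm{Der}_k(A)\to R$ be LR-admissible: $\nabla$ is left $A$-linear, $\nabla(\delta)a=a\nabla(\delta)+\delta(a)1_R$ and $\nabla([\delta,\delta'])=[\nabla(\delta),\nabla(\delta')]$ for all $\delta,\delta'\in\mathrm{Der}_k(A)$, $a\in A$. Let $\overline{\nabla}(\sum\delta_\alpha\mathbf{s}^\alpha)=\sum\nabla(\delta_\alpha)\mathbf{s}^\alpha$. Theorem. For all $p\ge1$ and all non-empty co-ideals $\Delta\subset\mathbb{N}^p$ the maps $\varepsilon:\mathrm{HS}^p_k(A;\Delta)\to\mathrm{Der}_k(A)[[\mathbf{s}]]_{\Delta,+}$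 and $\varepsilon:\mathcal{U}^p(R;\Delta)\to R[[\mathbf{s}]]_{\Delta,+}$ are bijective, and there is a unique HS-structure $\Psi$ on $R$ over $A/k$ such that $\varepsilon(\Psi^p_\Delta(D))=\overline{\nabla}(\varepsilon(D))$ for all $p\ge1$, all non-empty co-ideals $\Delta\subset\mathbb{N}^p$ and all $D\in\mathrm{HS}^p_k(A;\Delta)$. Moreover, if $R=\bigcup_{d\ge0}R_d$ is filtered (an increasing filtration by additive subgroups with $R_iR_j\subset R_{i+j}$ and $\iota(A)\subset R_0$) and $\mathrm{Im}\,\nabla\subset R_1$, then $\Psi$ is filtered: for all $p$, $\Delta$, $D$ and $\alpha\in\Delta$, the coefficient of $\mathbf{s}^\alpha$ in $\Psi^p_\Delta(D)$ lies in $R_{|\alpha|}$. -/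

import Mathlib

namespace HasseSchmidt

noncomputable section

open Finset.HasAntidiagonal (antidiagonal mem_antidiagonal)

/-- Non-empty co-ideals of `ℕ^p`: non-empty subsets `Δ` such that `α' ≤ α ∈ Δ` implies `α' ∈ Δ`,
for the componentwise order. -/
abbrev Coideal (p : ℕ) : Type :=
  {Δ : LowerSet (Fin p →₀ ℕ) // (Δ : Set (Fin p →₀ ℕ)).Nonempty}

theorem Coideal.zero_mem {p : ℕ} (Δ : Coideal p) : (0 : Fin p →₀ ℕ) ∈ Δ.1 := by
  obtain ⟨α, hα⟩ := Δ.2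
  exact Δ.1.lower (zero_le (a := α)) hα

theorem Coideal.fst_mem {p : ℕ} {Δ : Coideal p} {α : Fin p →₀ ℕ} (hα : α ∈ Δ.1)
    {x : (Fin p →₀ ℕ) × (Fin p →₀ ℕ)} (hx : x ∈ antidiagonal α) : x.1 ∈ Δ.1 :=
  Δ.1.lower (by rw [← mem_antidiagonal.1 hx]; exact le_self_add) hα

theorem Coideal.snd_mem {p : ℕ} {Δ : Coideal p} {α : Fin p →₀ ℕ} (hα : α ∈ Δ.1)
    {x : (Fin p →₀ ℕ) × (Fin p →₀ ℕ)} (hx : x ∈ antidiagonal α) : x.2 ∈ Δ.1 :=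
  Δ.1.lower (by rw [← mem_antidiagonal.1 hx]; exact le_add_self) hα

/-! ### Truncated power series -/

/-- The subgroup `Δ_M` of the power series `∑ m_α s^α` with `m_α = 0` for all `α ∈ Δ`. -/
def vanishing (M : Type*) [AddCommGroup M] {p : ℕ} (Δ : Coideal p) :
    AddSubgroup (MvPowerSeries (Fin p) M) where
  carrier := {m | ∀ α ∈ Δ.1, m α = 0}
  zero_mem' := fun _ _ => rfl
  add_mem' := fun {a b} ha hb α hα => by
    show a α + b α = 0
    rw [ha α hα, hb α hα, add_zero]
  neg_mem' := fun {a} ha α hα => by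
    show - a α = 0
    rw [ha α hα, neg_zero]

/-- For a ring `R`, the subgroup `Δ_R` is a two-sided ideal of `R[[s]]`. -/
def vanishingIdeal (R : Type*) [Ring R] {p : ℕ} (Δ : Coideal p) :
    Ideal (MvPowerSeries (Fin p) R) :=
  { vanishing R Δ with
    smul_mem' := fun c x hx α hα => by
      classical
      show MvPowerSeries.coeff α (c * x) = 0
      rw [MvPowerSeries.coeff_mul]
      refine Finset.sum_eq_zero fun q hq => ?_
      have h : MvPowerSeries.coeff q.2 x = 0 := hx q.2 (Coideal.snd_mem hα hq)
      rw [h, mul_zero] }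

instance (R : Type*) [Ring R] {p : ℕ} (Δ : Coideal p) : (vanishingIdeal R Δ).IsTwoSided where
  mul_mem_of_left := fun {x} c hx α hα => by
    classical
    show MvPowerSeries.coeff α (x * c) = 0
    rw [MvPowerSeries.coeff_mul]
    refine Finset.sum_eq_zero fun q hq => ?_
    have h : MvPowerSeries.coeff q.1 x = 0 := hx q.1 (Coideal.fst_mem hα hq)
    rw [h, zero_mul]

/-- `M[[s]]_Δ = M[[s]] / Δ_M`. -/
def TruncSeries (M : Type*) [AddCommGroup M] {p : ℕ} (Δ : Coideal p) : Type _ :=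
  MvPowerSeries (Fin p) M ⧸ vanishing M Δ

namespace TruncSeries

variable {p : ℕ} {Δ : Coideal p}

instance instAddCommGroup (M : Type*) [AddCommGroup M] (Δ : Coideal p) :
    AddCommGroup (TruncSeries M Δ) :=
  inferInstanceAs (AddCommGroup (MvPowerSeries (Fin p) M ⧸ vanishing M Δ))

instance instRing (R : Type*) [Ring R] (Δ : Coideal p) : Ring (TruncSeries R Δ) :=
  inferInstanceAs (Ring (MvPowerSeries (Fin p) R ⧸ vanishingIdeal R Δ))

instance instAlgebra (A : Type*) [CommRing A] (Δ : Coideal p) : Algebra A (TruncSeries A Δ) :=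
  inferInstanceAs (Algebra A (MvPowerSeries (Fin p) A ⧸ vanishingIdeal A Δ))

section AddGroup

variable {M N : Type*} [AddCommGroup M] [AddCommGroup N]

/-- The class of a power series in `M[[s]]_Δ`. -/
def proj (Δ : Coideal p) : MvPowerSeries (Fin p) M →+ TruncSeries M Δ :=
  QuotientAddGroup.mk' (vanishing M Δ)

/-- The coefficient of `s^α` in `M[[s]]`. -/
def evalAt (α : Fin p →₀ ℕ) : MvPowerSeries (Fin p) M →+ M where
  toFun m := m α
  map_zero' := rfl
  map_add' _ _ := rfl

theorem vanishing_le_ker {α : Fin p →₀ ℕ} (hα : α ∈ Δ.1) :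
    vanishing M Δ ≤ (evalAt α).ker :=
  fun _ hm => hm α hα

/-- The class of `∑ m_α s^α` in `M[[s]]_Δ`. -/
def ofFun (Δ : Coideal p) (m : (Fin p →₀ ℕ) → M) : TruncSeries M Δ :=
  proj Δ m

/-- The coefficient of `s^α` in `M[[s]]_Δ`, for `α ∈ Δ`. -/
def coeffOfMem (α : Fin p →₀ ℕ) (hα : α ∈ Δ.1) : TruncSeries M Δ →+ M :=
  QuotientAddGroup.lift (vanishing M Δ) (evalAt α) (vanishing_le_ker hα)

open Classical in
/-- The coefficient of `s^α`, for `α ∈ Δ`; it is set to `0` for `α ∉ Δ`. -/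
def coeff (α : Fin p →₀ ℕ) : TruncSeries M Δ →+ M :=
  if hα : α ∈ Δ.1 then coeffOfMem α hα else 0

theorem coeff_proj {α : Fin p →₀ ℕ} (hα : α ∈ Δ.1) (m : MvPowerSeries (Fin p) M) :
    coeff α (proj Δ m) = m α := by
  rw [coeff, dif_pos hα]
  rfl

theorem coeff_ofFun {α : Fin p →₀ ℕ} (hα : α ∈ Δ.1) (m : (Fin p →₀ ℕ) → M) :
    coeff α (ofFun Δ m) = m α :=
  coeff_proj hα m

theorem coeff_of_notMem {α : Fin p →₀ ℕ} (hα : α ∉ Δ.1) (m : TruncSeries M Δ) :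
    coeff α m = 0 := by
  rw [coeff, dif_neg hα]
  rfl

theorem proj_surjective : Function.Surjective (proj (M := M) Δ) :=
  QuotientAddGroup.mk'_surjective _

theorem ext {x y : TruncSeries M Δ} (h : ∀ α ∈ Δ.1, coeff α x = coeff α y) : x = y := by
  obtain ⟨x, rfl⟩ := proj_surjective x
  obtain ⟨y, rfl⟩ := proj_surjective y
  refine QuotientAddGroup.eq.2 fun α hα => ?_
  have := h α hα
  rw [coeff_proj hα, coeff_proj hα] at this
  show - x α + y α = 0
  rw [this, neg_add_cancel]

/-- The map `M[[s]]_Δ → N[[s]]_Δ` induced coefficientwise by an additive map `f : M → N`. -/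
def map (f : M →+ N) : TruncSeries M Δ →+ TruncSeries N Δ where
  toFun m := ofFun Δ fun α => f (coeff α m)
  map_zero' := ext fun α hα => by rw [coeff_ofFun hα]; simp
  map_add' x y := ext fun α hα => by rw [map_add, coeff_ofFun hα, coeff_ofFun hα, coeff_ofFun hα]; simp

theorem coeff_map (f : M →+ N) (m : TruncSeries M Δ) {α : Fin p →₀ ℕ} (hα : α ∈ Δ.1) :
    coeff α (map f m) = f (coeff α m) :=
  coeff_ofFun hα _

/-- `M[[s]]_{Δ,+}`: the series with vanishing constant term. -/
def plus (M : Type*) [AddCommGroup M] (Δ : Coideal p) : AddSubgroup (TruncSeries M Δ) :=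
  (coeff (M := M) (Δ := Δ) 0).ker

/-- The restriction `M[[s]]_{Δ,+} → N[[s]]_{Δ,+}` of `map f`. -/
def mapPlus (f : M →+ N) (m : plus M Δ) : plus N Δ :=
  ⟨map f m.1, by
    rw [plus, AddMonoidHom.mem_ker, coeff_map f _ Δ.zero_mem,
      AddMonoidHom.mem_ker.1 m.2, map_zero]⟩

/-- The Euler derivation `χ = ∑ s_i ∂/∂s_i`, that is `χ (∑ m_α s^α) = ∑ |α| m_α s^α`. -/
def euler (m : TruncSeries M Δ) : TruncSeries M Δ :=
  ofFun Δ fun α => α.degree • coeff α m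

theorem coeff_euler (m : TruncSeries M Δ) {α : Fin p →₀ ℕ} (hα : α ∈ Δ.1) :
    coeff α (euler m) = α.degree • coeff α m :=
  coeff_ofFun hα _

end AddGroup

section Ring

variable {R : Type*} [Ring R]

theorem coeff_mul (x y : TruncSeries R Δ) {α : Fin p →₀ ℕ} (hα : α ∈ Δ.1) :
    coeff α (x * y) = ∑ q ∈ antidiagonal α, coeff q.1 x * coeff q.2 y := by
  obtain ⟨x, rfl⟩ := proj_surjective x
  obtain ⟨y, rfl⟩ := proj_surjective y
  have h : proj Δ x * proj Δ y = proj Δ (x * y) := rfl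
  rw [h, coeff_proj hα]
  refine (MvPowerSeries.coeff_mul α x y).trans (Finset.sum_congr rfl fun q hq => ?_)
  rw [coeff_proj (Coideal.fst_mem hα hq), coeff_proj (Coideal.snd_mem hα hq)]
  rfl

theorem coeff_zero_mul (x y : TruncSeries R Δ) : coeff 0 (x * y) = coeff 0 x * coeff 0 y := by
  rw [coeff_mul x y Δ.zero_mem]
  simp

theorem coeff_zero_one : coeff 0 (1 : TruncSeries R Δ) = 1 := by
  have h : (1 : TruncSeries R Δ) = proj Δ 1 := rfl
  rw [h, coeff_proj Δ.zero_mem]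
  show MvPowerSeries.coeff 0 (1 : MvPowerSeries (Fin p) R) = 1
  exact MvPowerSeries.coeff_zero_one

theorem coeff_one_of_ne {α : Fin p →₀ ℕ} (h0 : α ≠ 0) : coeff α (1 : TruncSeries R Δ) = 0 := by
  by_cases hα : α ∈ Δ.1
  · have h : (1 : TruncSeries R Δ) = proj Δ 1 := rfl
    rw [h, coeff_proj hα]
    classical
    exact (MvPowerSeries.coeff_one α).trans (if_neg h0)
  · exact coeff_of_notMem hα _

theorem isUnit_of_coeff_zero {x : TruncSeries R Δ} (hx : coeff 0 x = 1) : IsUnit x := by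
  obtain ⟨x, rfl⟩ := proj_surjective x
  rw [coeff_proj Δ.zero_mem] at hx
  have h1 : MvPowerSeries.constantCoeff x = ((1 : Rˣ) : R) := hx
  exact ⟨⟨proj Δ x, proj Δ (x.invOfUnit 1), congrArg (proj Δ) (MvPowerSeries.mul_invOfUnit x 1 h1),
    congrArg (proj Δ) (MvPowerSeries.invOfUnit_mul x 1 h1)⟩, rfl⟩

theorem euler_mul (x y : TruncSeries R Δ) : euler (x * y) = euler x * y + x * euler y := by
  refine ext fun α hα => ?_
  rw [map_add, coeff_euler _ hα, coeff_mul _ _ hα, coeff_mul _ _ hα, coeff_mul _ _ hα,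
    Finset.smul_sum, ← Finset.sum_add_distrib]
  refine Finset.sum_congr rfl fun q hq => ?_
  rw [coeff_euler _ (Coideal.fst_mem hα hq), coeff_euler _ (Coideal.snd_mem hα hq),
    smul_mul_assoc, mul_smul_comm, ← add_smul, ← map_add, mem_antidiagonal.1 hq]

/-- The variable `s_i` as an element of `R[[s]]_Δ`. -/
def X (Δ : Coideal p) (i : Fin p) : TruncSeries R Δ :=
  proj Δ (MvPowerSeries.X i)

/-- The monomial `s^α` as an element of `R[[s]]_Δ`. -/
def sPow (Δ : Coideal p) (α : Fin p →₀ ℕ) : TruncSeries R Δ :=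
  proj Δ (MvPowerSeries.monomial α 1)

/-- The constant series `a`. -/
def const (Δ : Coideal p) (a : R) : TruncSeries R Δ :=
  proj Δ (MvPowerSeries.C a)

theorem const_mul (a b : R) : const Δ (a * b) = const Δ a * const Δ b :=
  congrArg (proj Δ) (map_mul MvPowerSeries.C a b)

theorem coeff_const (a : R) {α : Fin p →₀ ℕ} (hα : α ∈ Δ.1) :
    coeff α (const Δ a) = if α = 0 then a else 0 := by
  classical
  rw [const, coeff_proj hα]
  exact MvPowerSeries.coeff_C α a

end Ring

end TruncSeries

open TruncSeries

/-! ### The groups `U^p(R; Δ)` -/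

/-- `U^p(R; Δ)`: the group of units of `R[[s]]_Δ` with constant term `1`. -/
def OneUnits (R : Type*) [Ring R] {p : ℕ} (Δ : Coideal p) : Subgroup (TruncSeries R Δ)ˣ where
  carrier := {r | coeff 0 (r : TruncSeries R Δ) = 1}
  mul_mem' := fun {a b} ha hb => by
    show coeff 0 ((a : TruncSeries R Δ) * (b : TruncSeries R Δ)) = 1
    rw [coeff_zero_mul, ha, hb, one_mul]
  one_mem' := coeff_zero_one
  inv_mem' := fun {a} ha => by
    have h : coeff 0 ((a : TruncSeries R Δ) * ((a⁻¹ : (TruncSeries R Δ)ˣ) : TruncSeries R Δ)) = 1 := by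
      rw [Units.mul_inv, coeff_zero_one]
    rwa [coeff_zero_mul, show coeff 0 (a : TruncSeries R Δ) = 1 from ha, one_mul] at h

/-- An element of `U^p(R; Δ)` as a series. -/
def ser {R : Type*} [Ring R] {p : ℕ} {Δ : Coideal p} (r : OneUnits R Δ) :
    TruncSeries R Δ :=
  (r.1 : TruncSeries R Δ)

section Ser

variable {R : Type*} [Ring R] {p : ℕ} {Δ : Coideal p}

theorem ser_mul (r r' : OneUnits R Δ) : ser (r * r') = ser r * ser r' := rfl

theorem ser_one : ser (1 : OneUnits R Δ) = 1 := rfl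

theorem ser_mul_inv (r : OneUnits R Δ) : ser r * ser r⁻¹ = 1 := Units.mul_inv r.1

theorem ser_inv_mul (r : OneUnits R Δ) : ser r⁻¹ * ser r = 1 := Units.inv_mul r.1

end Ser

/-- A series with constant term `1`, as an element of `U^p(R; Δ)`. -/
def ofSer {R : Type*} [Ring R] {p : ℕ} {Δ : Coideal p} (x : TruncSeries R Δ)
    (hx : coeff 0 x = 1) : OneUnits R Δ :=
  ⟨(isUnit_of_coeff_zero hx).unit, hx⟩

section Eps

variable {R : Type*} [Ring R] {p : ℕ} {Δ : Coideal p}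

/-- The logarithmic derivative `ε(r) = r^* χ(r)` of `r ∈ U^p(R; Δ)`. -/
def eps (r : OneUnits R Δ) : TruncSeries R Δ :=
  ser r⁻¹ * euler (ser r)

theorem series_mul_eps (r : OneUnits R Δ) : ser r * eps r = euler (ser r) := by
  rw [eps, ← mul_assoc, ser_mul_inv, one_mul]

theorem coeff_zero_eps (r : OneUnits R Δ) : coeff 0 (eps r) = 0 := by
  rw [eps, coeff_zero_mul, coeff_euler _ Δ.zero_mem]
  simp

/-- The map `ε : U^p(R; Δ) → R[[s]]_{Δ,+}`. -/
def epsPlus (r : OneUnits R Δ) : plus R Δ :=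
  ⟨eps r, coeff_zero_eps r⟩

end Eps

/-! ### Hasse-Schmidt derivations -/

section HS

variable {k A : Type*} [CommRing k] [CommRing A] [Algebra k A] {p : ℕ} {Δ : Coideal p}

/-- The ring `End_k(A)[[s]]_Δ`. -/
abbrev EndSeries (k A : Type*) [CommRing k] [CommRing A] [Algebra k A] {p : ℕ} (Δ : Coideal p) :
    Type _ :=
  @TruncSeries (Module.End k A) Ring.toAddCommGroup p Δ

/-- For `r ∈ End_k(A)[[s]]_Δ`, the map `r̃ : A[[s]]_Δ → A[[s]]_Δ` sending `∑ a_γ s^γ` to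
`∑_α (∑_{β+γ=α} r_β(a_γ)) s^α`. -/
def tilde (r : EndSeries k A Δ) (f : TruncSeries A Δ) : TruncSeries A Δ :=
  ofFun Δ fun α => ∑ q ∈ antidiagonal α, coeff q.1 r (coeff q.2 f)

theorem coeff_tilde (r : EndSeries k A Δ) (f : TruncSeries A Δ)
    {α : Fin p →₀ ℕ} (hα : α ∈ Δ.1) :
    coeff α (tilde r f) = ∑ q ∈ antidiagonal α, coeff q.1 r (coeff q.2 f) :=
  coeff_ofFun hα _

/-- The Leibniz identities `D_α(xy) = ∑_{β+γ=α} D_β(x) D_γ(y)`, `α ∈ Δ`. -/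
def IsLeibniz (D : EndSeries k A Δ) : Prop :=
  ∀ α ∈ Δ.1, ∀ x y : A,
    coeff α D (x * y) = ∑ q ∈ antidiagonal α, coeff q.1 D x * coeff q.2 D y

theorem tilde_add (r : EndSeries k A Δ) (f g : TruncSeries A Δ) :
    tilde r (f + g) = tilde r f + tilde r g := by
  refine ext fun α hα => ?_
  rw [map_add, coeff_tilde _ _ hα, coeff_tilde _ _ hα, coeff_tilde _ _ hα,
    ← Finset.sum_add_distrib]
  simp

theorem tilde_mul (r r' : EndSeries k A Δ) (f : TruncSeries A Δ) :
    tilde (r * r') f = tilde r (tilde r' f) := by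
  refine ext fun α hα => ?_
  rw [coeff_tilde _ _ hα, coeff_tilde _ _ hα]
  have h1 : ∀ q ∈ antidiagonal α, coeff q.1 (r * r') (coeff q.2 f) =
      ∑ t ∈ antidiagonal q.1, coeff t.1 r (coeff t.2 r' (coeff q.2 f)) := fun q hq => by
    rw [coeff_mul _ _ (Coideal.fst_mem hα hq), LinearMap.sum_apply]
    rfl
  have h2 : ∀ q ∈ antidiagonal α, coeff q.1 r (coeff q.2 (tilde r' f)) =
      ∑ t ∈ antidiagonal q.2, coeff q.1 r (coeff t.1 r' (coeff t.2 f)) := fun q hq => by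
    rw [coeff_tilde _ _ (Coideal.snd_mem hα hq), map_sum]
  rw [Finset.sum_congr rfl h1, Finset.sum_congr rfl h2, Finset.sum_sigma', Finset.sum_sigma']
  refine Finset.sum_nbij' (fun x => ⟨(x.2.1, x.2.2 + x.1.2), (x.2.2, x.1.2)⟩)
    (fun x => ⟨(x.1.1 + x.2.1, x.2.2), (x.1.1, x.2.1)⟩) ?_ ?_ ?_ ?_ ?_
  · rintro ⟨⟨a, b⟩, ⟨c, d⟩⟩ h
    simp only [Finset.mem_sigma, mem_antidiagonal, and_true] at h ⊢
    rw [← h.1, ← h.2, add_assoc]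
  · rintro ⟨⟨a, b⟩, ⟨c, d⟩⟩ h
    simp only [Finset.mem_sigma, mem_antidiagonal, and_true] at h ⊢
    rw [← h.1, ← h.2, add_assoc]
  · rintro ⟨⟨a, b⟩, ⟨c, d⟩⟩ h
    simp only [Finset.mem_sigma, mem_antidiagonal] at h
    obtain ⟨rfl, rfl⟩ := h
    rfl
  · rintro ⟨⟨a, b⟩, ⟨c, d⟩⟩ h
    simp only [Finset.mem_sigma, mem_antidiagonal] at h
    obtain ⟨rfl, rfl⟩ := h
    rfl
  · rintro ⟨⟨a, b⟩, ⟨c, d⟩⟩ _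
    rfl

theorem tilde_one (f : TruncSeries A Δ) :
    tilde (1 : EndSeries k A Δ) f = f := by
  refine ext fun α hα => ?_
  rw [coeff_tilde _ _ hα, Finset.sum_eq_single (0, α)]
  · rw [coeff_zero_one]; rfl
  · rintro ⟨b, c⟩ h hne
    have hb : b ≠ 0 := by
      rintro rfl
      simp only [mem_antidiagonal, zero_add] at h
      exact hne (by rw [h])
    rw [coeff_one_of_ne hb]; rfl
  · intro h
    exact absurd (by simp) h

theorem coeff_tilde_const (r : EndSeries k A Δ) (a : A) {α : Fin p →₀ ℕ}
    (hα : α ∈ Δ.1) : coeff α (tilde r (const Δ a)) = coeff α r a := by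
  rw [coeff_tilde _ _ hα, Finset.sum_eq_single (α, 0)]
  · rw [coeff_const _ Δ.zero_mem, if_pos rfl]
  · rintro ⟨b, c⟩ h hne
    have hc : c ≠ 0 := by
      rintro rfl
      simp only [mem_antidiagonal, add_zero] at h
      exact hne (by rw [h])
    rw [coeff_const _ (Coideal.snd_mem hα h), if_neg hc, map_zero]
  · intro h
    exact absurd (by simp) h

theorem isLeibniz_iff (D : EndSeries k A Δ) :
    IsLeibniz D ↔ ∀ f g : TruncSeries A Δ, tilde D (f * g) = tilde D f * tilde D g := by
  constructor
  · intro hD f g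
    refine ext fun α hα => ?_
    rw [coeff_tilde _ _ hα, coeff_mul _ _ hα]
    have h1 : ∀ q ∈ antidiagonal α, coeff q.1 D (coeff q.2 (f * g)) =
        ∑ t ∈ antidiagonal q.2, ∑ u ∈ antidiagonal q.1,
          coeff u.1 D (coeff t.1 f) * coeff u.2 D (coeff t.2 g) := fun q hq => by
      rw [coeff_mul _ _ (Coideal.snd_mem hα hq), map_sum]
      exact Finset.sum_congr rfl fun t _ => hD _ (Coideal.fst_mem hα hq) _ _
    have h2 : ∀ q ∈ antidiagonal α, coeff q.1 (tilde D f) * coeff q.2 (tilde D g) =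
        ∑ t ∈ antidiagonal q.1, ∑ u ∈ antidiagonal q.2,
          coeff t.1 D (coeff t.2 f) * coeff u.1 D (coeff u.2 g) := fun q hq => by
      rw [coeff_tilde _ _ (Coideal.fst_mem hα hq), coeff_tilde _ _ (Coideal.snd_mem hα hq),
        Finset.sum_mul_sum]
    rw [Finset.sum_congr rfl h1, Finset.sum_congr rfl h2]
    simp only [Finset.sum_sigma']
    refine Finset.sum_nbij'
      (fun x => ⟨(x.2.2.1 + x.2.1.1, x.2.2.2 + x.2.1.2),
        ⟨(x.2.2.1, x.2.1.1), (x.2.2.2, x.2.1.2)⟩⟩)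
      (fun x => ⟨(x.2.1.1 + x.2.2.1, x.2.1.2 + x.2.2.2),
        ⟨(x.2.1.2, x.2.2.2), (x.2.1.1, x.2.2.1)⟩⟩)
      ?_ ?_ ?_ ?_ ?_
    · rintro ⟨⟨a, b⟩, ⟨⟨c, d⟩, ⟨e, f⟩⟩⟩ h
      simp only [Finset.mem_sigma, mem_antidiagonal, and_true] at h ⊢
      rw [← h.1, ← h.2.1, ← h.2.2]; abel
    · rintro ⟨⟨a, b⟩, ⟨⟨c, d⟩, ⟨e, f⟩⟩⟩ h
      simp only [Finset.mem_sigma, mem_antidiagonal, and_true] at h ⊢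
      rw [← h.1, ← h.2.1, ← h.2.2]; abel
    · rintro ⟨⟨a, b⟩, ⟨⟨c, d⟩, ⟨e, f⟩⟩⟩ h
      simp only [Finset.mem_sigma, mem_antidiagonal] at h
      obtain ⟨rfl, rfl, rfl⟩ := h
      rfl
    · rintro ⟨⟨a, b⟩, ⟨⟨c, d⟩, ⟨e, f⟩⟩⟩ h
      simp only [Finset.mem_sigma, mem_antidiagonal] at h
      obtain ⟨rfl, rfl, rfl⟩ := h
      rfl
    · rintro ⟨⟨a, b⟩, ⟨⟨c, d⟩, ⟨e, f⟩⟩⟩ _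
      rfl
  · intro h α hα x y
    have := congrArg (coeff α) (h (const Δ x) (const Δ y))
    rw [← const_mul, coeff_tilde_const _ _ hα, coeff_mul _ _ hα] at this
    rw [this]
    refine Finset.sum_congr rfl fun q hq => ?_
    rw [coeff_tilde_const _ _ (Coideal.fst_mem hα hq),
      coeff_tilde_const _ _ (Coideal.snd_mem hα hq)]

theorem IsLeibniz.mul {D E : EndSeries k A Δ} (hD : IsLeibniz D)
    (hE : IsLeibniz E) : IsLeibniz (D * E) :=
  (isLeibniz_iff _).2 fun f g => by
    rw [tilde_mul, (isLeibniz_iff _).1 hE, (isLeibniz_iff _).1 hD, tilde_mul, tilde_mul]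

theorem isLeibniz_one : IsLeibniz (1 : EndSeries k A Δ) :=
  (isLeibniz_iff _).2 fun f g => by rw [tilde_one, tilde_one, tilde_one]

theorem IsLeibniz.of_mul_eq_one {D E : EndSeries k A Δ} (hD : IsLeibniz D)
    (h1 : D * E = 1) (h2 : E * D = 1) : IsLeibniz E := by
  have e1 : ∀ f, tilde D (tilde E f) = f := fun f => by rw [← tilde_mul, h1, tilde_one]
  have e2 : ∀ f, tilde E (tilde D f) = f := fun f => by rw [← tilde_mul, h2, tilde_one]
  refine (isLeibniz_iff _).2 fun f g => ?_
  rw [← e2 (tilde E f * tilde E g), (isLeibniz_iff _).1 hD, e1, e1]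

variable (k A Δ) in
/-- `HS^p_k(A; Δ)`: the group of `(p, Δ)`-variate Hasse-Schmidt derivations of `A` over `k`, seen
as a subgroup of `U^p(End_k(A); Δ)`. -/
def HSDer : Subgroup (OneUnits (Module.End k A) Δ) where
  carrier := {D | IsLeibniz (ser D)}
  mul_mem' := fun {D E} hD hE => by
    show IsLeibniz (ser (D * E))
    rw [ser_mul]
    exact IsLeibniz.mul hD hE
  one_mem' := by
    show IsLeibniz (ser 1)
    rw [ser_one]
    exact isLeibniz_one
  inv_mem' := fun {D} hD => by
    show IsLeibniz (ser D⁻¹)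
    exact IsLeibniz.of_mul_eq_one hD (ser_mul_inv D) (ser_inv_mul D)

theorem tilde_euler (r : EndSeries k A Δ) (f : TruncSeries A Δ) :
    euler (tilde r f) = tilde (euler r) f + tilde r (euler f) := by
  refine ext fun α hα => ?_
  rw [map_add, coeff_euler _ hα, coeff_tilde _ _ hα, coeff_tilde _ _ hα, coeff_tilde _ _ hα,
    Finset.smul_sum, ← Finset.sum_add_distrib]
  refine Finset.sum_congr rfl fun q hq => ?_
  rw [coeff_euler _ (Coideal.fst_mem hα hq), coeff_euler _ (Coideal.snd_mem hα hq),
    map_nsmul, LinearMap.smul_apply, ← add_smul, ← map_add, mem_antidiagonal.1 hq]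

/-- The coefficients of `ε(D)`, for a Hasse-Schmidt derivation `D`, satisfy the Leibniz rule. -/
theorem coeff_eps_leibniz (D : HSDer k A Δ) (α : Fin p →₀ ℕ) (x y : A) :
    coeff α (eps D.1) (x * y) = x • coeff α (eps D.1) y + y • coeff α (eps D.1) x := by
  by_cases hα : α ∈ Δ.1
  swap
  · rw [coeff_of_notMem hα]; simp
  have hD := (isLeibniz_iff _).1 D.2
  have hinj : Function.Injective (tilde (ser D.1)) :=
    Function.LeftInverse.injective (g := tilde (ser D.1⁻¹)) fun f => by
      rw [← tilde_mul, ser_inv_mul, tilde_one]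
  have key : ∀ f, tilde (ser D.1) (tilde (eps D.1) f) + tilde (ser D.1) (euler f)
      = euler (tilde (ser D.1) f) := fun f => by
    rw [← tilde_mul, series_mul_eps, tilde_euler]
  have hder : tilde (eps D.1) (const Δ x * const Δ y) =
      tilde (eps D.1) (const Δ x) * const Δ y + const Δ x * tilde (eps D.1) (const Δ y) := by
    apply hinj
    apply add_right_cancel (b := tilde (ser D.1) (euler (const Δ x * const Δ y)))
    rw [key, hD, euler_mul, euler_mul, ← key, ← key, tilde_add, tilde_add, hD, hD, hD, hD]
    noncomm_ring
  have := congrArg (coeff α) hder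
  rw [← const_mul, coeff_tilde_const _ _ hα, map_add, coeff_mul _ _ hα, coeff_mul _ _ hα,
    Finset.sum_eq_single (α, 0), Finset.sum_eq_single (0, α)] at this
  · rw [this, coeff_tilde_const _ _ hα, coeff_tilde_const _ _ hα,
      coeff_const _ Δ.zero_mem, coeff_const _ Δ.zero_mem, if_pos rfl, if_pos rfl, smul_eq_mul,
      smul_eq_mul]
    ring
  · rintro ⟨b, c⟩ h hne
    have hb : b ≠ 0 := by
      rintro rfl
      simp only [mem_antidiagonal, zero_add] at h
      exact hne (by rw [h])
    rw [coeff_const _ (Coideal.fst_mem hα h), if_neg hb, zero_mul]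
  · intro h
    exact absurd (by simp) h
  · rintro ⟨b, c⟩ h hne
    have hc : c ≠ 0 := by
      rintro rfl
      simp only [mem_antidiagonal, add_zero] at h
      exact hne (by rw [h])
    rw [coeff_const _ (Coideal.snd_mem hα h), if_neg hc, mul_zero]
  · intro h
    exact absurd (by simp) h

/-- The map `ε : HS^p_k(A; Δ) → Der_k(A)[[s]]_{Δ,+}`: the coefficients of the logarithmic
derivative `ε(D) ∈ End_k(A)[[s]]_Δ`, seen as derivations. -/
def epsHS (D : HSDer k A Δ) : plus (Derivation k A A) Δ :=
  ⟨ofFun Δ fun α => Derivation.mk' (coeff α (eps D.1)) (coeff_eps_leibniz D α), by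
    refine AddMonoidHom.mem_ker.2 ?_
    rw [coeff_ofFun Δ.zero_mem]
    ext x
    show coeff 0 (eps D.1) x = 0
    rw [coeff_zero_eps]
    rfl⟩

theorem coeff_epsHS (D : HSDer k A Δ) {α : Fin p →₀ ℕ} (hα : α ∈ Δ.1) :
    ((coeff α (epsHS D).1 : Derivation k A A) : A →ₗ[k] A) = coeff α (eps D.1) := by
  rw [epsHS, coeff_ofFun hα]
  rfl

end HS

/-! ### Substitution maps -/

section Subst

variable {A : Type*} [CommRing A] {p q : ℕ}

/-- Substitution maps `A[[s]]_Δ → A[[t]]_Ω`: the `A`-algebra maps `φ` such that each `φ(s_i)` has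
order at least `1`, that is, has no constant term. -/
structure SubstMap (A : Type*) [CommRing A] {p q : ℕ} (Δ : Coideal p) (Ω : Coideal q) where
  toAlgHom : TruncSeries A Δ →ₐ[A] TruncSeries A Ω
  order_pos : ∀ i : Fin p, coeff 0 (toAlgHom (X Δ i)) = 0

variable {Δ : Coideal p} {Ω : Coideal q}

/-- For a `k`-algebra `R` over `A` with structure map `ι`, the series
`φ • r = ∑_α φ(s^α) r_α`. -/
def SubstMap.bullet {R : Type*} [Ring R] (φ : SubstMap A Δ Ω) (ι : A →+* R)
    (r : TruncSeries R Δ) : TruncSeries R Ω :=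
  ofFun Ω fun e => ∑ᶠ α : Fin p →₀ ℕ, ι (coeff e (φ.toAlgHom (sPow Δ α))) * coeff α r

/-- If `f` has order at least `n`, so has `φ(f)`. -/
theorem SubstMap.coeff_eq_zero (φ : SubstMap A Δ Ω) (n : ℕ) :
    ∀ f : MvPowerSeries (Fin p) A, (∀ α, α.degree < n → f α = 0) →
      ∀ e, e.degree < n → coeff e (φ.toAlgHom (proj Δ f)) = 0 := by
  classical
  induction n with
  | zero => intro f _ e he; omega
  | succ n ih =>
    intro f hf e he
    by_cases heΩ : e ∈ Ω.1
    swap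
    · exact coeff_of_notMem heΩ _
    let g : Fin p → MvPowerSeries (Fin p) A := fun i β =>
      if ∀ j < i, β j = 0 then f (β + Finsupp.single i 1) else 0
    have hg : ∀ i, ∀ β, β.degree < n → g i β = 0 := fun i β hβ => by
      show (if _ then _ else _) = _
      rw [hf _ (by rw [map_add, Finsupp.degree_single]; omega), ite_self]
    have hsum : f = ∑ i, MvPowerSeries.X i * g i := by
      ext α
      rw [map_sum]
      have hX : ∀ i, MvPowerSeries.coeff α (MvPowerSeries.X i * g i) =
          if (∀ j < i, α j = 0) ∧ α i ≠ 0 then f α else 0 := fun i => by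
        rw [MvPowerSeries.X, MvPowerSeries.coeff_monomial_mul]
        by_cases hi : α i = 0
        · rw [if_neg, if_neg]
          · exact fun h => h.2 hi
          · intro h
            have := h i
            simp [hi] at this
        · have hle : Finsupp.single i 1 ≤ α := by
            rw [Finsupp.single_le_iff]; omega
          rw [if_pos hle, one_mul]
          show (if _ then _ else _) = _
          rw [tsub_add_cancel_of_le hle]
          refine if_congr ?_ rfl rfl
          constructor
          · intro h
            refine ⟨fun j hj => ?_, hi⟩
            have := h j hj
            rwa [Finsupp.tsub_apply, Finsupp.single_eq_of_ne (by exact hj.ne), tsub_zero] at this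
          · intro h j hj
            rw [Finsupp.tsub_apply, h.1 j hj, zero_tsub]
      rw [Finset.sum_congr rfl fun i _ => hX i]
      by_cases h0 : α = 0
      · subst h0
        have : f 0 = 0 := hf 0 (by simp)
        show f 0 = _
        simp [this]
      · have hne : α.support.Nonempty := Finsupp.support_nonempty_iff.2 h0
        rw [Finset.sum_eq_single (α.support.min' hne)]
        · rw [if_pos]
          · rfl
          · refine ⟨fun j hj => ?_, Finsupp.mem_support_iff.1 (Finset.min'_mem _ hne)⟩
            by_contra hj0
            exact absurd (Finset.min'_le _ _ (Finsupp.mem_support_iff.2 hj0)) (not_le.2 hj)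
        · intro i _ hi
          rw [if_neg]
          rintro ⟨h1, h2⟩
          refine hi (le_antisymm ?_ (Finset.min'_le _ _ (Finsupp.mem_support_iff.2 h2)))
          by_contra hlt
          exact Finsupp.mem_support_iff.1 (Finset.min'_mem _ hne) (h1 _ (not_le.1 hlt))
        · intro h
          exact absurd (Finset.mem_univ _) h
    have hmk : proj Δ f = ∑ i, X Δ i * proj Δ (g i) := by
      conv_lhs => rw [hsum]
      rw [map_sum]
      rfl
    rw [hmk, map_sum, map_sum]
    refine Finset.sum_eq_zero fun i _ => ?_
    rw [map_mul, coeff_mul _ _ heΩ]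
    refine Finset.sum_eq_zero fun t ht => ?_
    by_cases h0 : t.1 = 0
    · rw [h0, φ.order_pos, zero_mul]
    · have hd : t.1.degree + t.2.degree = e.degree := by
        rw [← map_add, mem_antidiagonal.1 ht]
      have hd1 : t.1.degree ≠ 0 := fun h => h0 ((Finsupp.degree_eq_zero_iff _).1 h)
      rw [ih (g i) (hg i) t.2 (by omega), mul_zero]

theorem finite_degree_le (p n : ℕ) : {α : Fin p →₀ ℕ | α.degree ≤ n}.Finite := by
  exact Finsupp.finite_of_degree_le n

theorem SubstMap.coeff_sPow_eq_zero (φ : SubstMap A Δ Ω) {α : Fin p →₀ ℕ} {e : Fin q →₀ ℕ}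
    (h : e.degree < α.degree) : coeff e (φ.toAlgHom (sPow Δ α)) = 0 := by
  classical
  refine φ.coeff_eq_zero α.degree _ (fun β hβ => ?_) e h
  refine (MvPowerSeries.coeff_monomial β α (1 : A)).trans (if_neg ?_)
  rintro rfl
  exact lt_irrefl _ hβ

/-- The sums defining `φ • r` are finite. -/
theorem SubstMap.bullet_finite {R : Type*} [Ring R] (φ : SubstMap A Δ Ω) (ι : A →+* R)
    (r : TruncSeries R Δ) (e : Fin q →₀ ℕ) :
    (Function.support fun α : Fin p →₀ ℕ =>
      ι (coeff e (φ.toAlgHom (sPow Δ α))) * coeff α r) ⊆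
      ((finite_degree_le p e.degree).toFinset : Set (Fin p →₀ ℕ)) := by
  intro α hα
  rw [Set.Finite.coe_toFinset]
  by_contra hlt
  refine hα ?_
  show ι (coeff e (φ.toAlgHom (sPow Δ α))) * coeff α r = 0
  rw [φ.coeff_sPow_eq_zero (not_le.1 hlt), map_zero, zero_mul]

theorem SubstMap.coeff_bullet {R : Type*} [Ring R] (φ : SubstMap A Δ Ω) (ι : A →+* R)
    (r : TruncSeries R Δ) {e : Fin q →₀ ℕ} (he : e ∈ Ω.1) :
    coeff e (φ.bullet ι r) = ∑ α ∈ (finite_degree_le p e.degree).toFinset,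
      ι (coeff e (φ.toAlgHom (sPow Δ α))) * coeff α r := by
  rw [bullet, coeff_ofFun he]
  exact finsum_eq_sum_of_support_subset _ (φ.bullet_finite ι r e)

theorem coeff_smul (a : A) (f : TruncSeries A Ω) {e : Fin q →₀ ℕ} (he : e ∈ Ω.1) :
    coeff e (a • f) = a * coeff e f := by
  obtain ⟨f, rfl⟩ := proj_surjective f
  have h : a • proj Ω f = proj Ω (a • f) := rfl
  rw [h, coeff_proj he, coeff_proj he]
  rfl

/-- A substitution map is determined by its values on monomials. -/
theorem SubstMap.coeff_apply (φ : SubstMap A Δ Ω) (f : TruncSeries A Δ) {e : Fin q →₀ ℕ}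
    (he : e ∈ Ω.1) :
    coeff e (φ.toAlgHom f) = ∑ α ∈ (finite_degree_le p e.degree).toFinset,
      coeff e (φ.toAlgHom (sPow Δ α)) * coeff α f := by
  classical
  obtain ⟨m, hm⟩ : ∃ m : MvPowerSeries (Fin p) A, m = fun α => coeff α f := ⟨_, rfl⟩
  have hf : proj Δ m = f := ext fun α hα => by rw [coeff_proj hα, hm]
  set s := (finite_degree_le p e.degree).toFinset with hs
  have h0 : coeff e (φ.toAlgHom (proj Δ (m - ∑ α ∈ s, MvPowerSeries.monomial α (m α)))) = 0 := by
    refine φ.coeff_eq_zero (e.degree + 1) _ (fun β hβ => ?_) e (Nat.lt_succ_self _)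
    show MvPowerSeries.coeff β (m - ∑ α ∈ s, MvPowerSeries.monomial α (m α)) = 0
    rw [map_sub, map_sum, Finset.sum_eq_single β]
    · rw [MvPowerSeries.coeff_monomial_same]
      exact sub_self _
    · intro α _ hα
      rw [MvPowerSeries.coeff_monomial, if_neg (Ne.symm hα)]
    · intro h
      refine absurd ?_ h
      rw [hs, Set.Finite.mem_toFinset]
      exact Nat.lt_succ_iff.1 hβ
  rw [map_sub, map_sub, map_sub, sub_eq_zero, hf] at h0
  rw [h0, map_sum, map_sum, map_sum]
  refine Finset.sum_congr rfl fun α _ => ?_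
  have h1 : proj Δ (MvPowerSeries.monomial α (m α)) = m α • sPow Δ α := by
    have : MvPowerSeries.monomial α (m α) = m α • MvPowerSeries.monomial α (1 : A) := by
      rw [← map_smul, smul_eq_mul, mul_one]
    rw [this]
    rfl
  rw [h1, map_smul, coeff_smul _ _ he, mul_comm, hm]

theorem SubstMap.coeff_zero_bullet {R : Type*} [Ring R] (φ : SubstMap A Δ Ω) (ι : A →+* R)
    (r : TruncSeries R Δ) : coeff 0 (φ.bullet ι r) = coeff 0 r := by
  rw [φ.coeff_bullet ι r Ω.zero_mem, Finset.sum_eq_single 0]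
  · have h : (sPow Δ 0 : TruncSeries A Δ) = 1 := rfl
    rw [h, map_one, coeff_zero_one, map_one, one_mul]
  · intro α _ hα
    rw [φ.coeff_sPow_eq_zero, map_zero, zero_mul]
    rw [map_zero]
    exact Nat.pos_of_ne_zero fun h => hα ((Finsupp.degree_eq_zero_iff _).1 h)
  · intro h
    exact absurd (by simp) h

/-- The action `r ↦ φ • r` as a map `U^p(R; Δ) → U^q(R; Ω)`. -/
def SubstMap.actUnits {R : Type*} [Ring R] (φ : SubstMap A Δ Ω) (ι : A →+* R)
    (r : OneUnits R Δ) : OneUnits R Ω :=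
  ofSer (φ.bullet ι (ser r)) ((φ.coeff_zero_bullet ι (ser r)).trans r.2)

variable {k : Type*} [CommRing k] [Algebra k A]

theorem SubstMap.coeff_bullet_lmul (φ : SubstMap A Δ Ω) (D : EndSeries k A Δ)
    (a : A) {e : Fin q →₀ ℕ} (he : e ∈ Ω.1) :
    coeff e (φ.bullet (Algebra.lmul k A).toRingHom D) a =
      coeff e (φ.toAlgHom (tilde D (const Δ a))) := by
  rw [φ.coeff_bullet _ _ he, φ.coeff_apply _ he, LinearMap.sum_apply]
  refine Finset.sum_congr rfl fun α _ => ?_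
  by_cases hα : α ∈ Δ.1
  · rw [coeff_tilde_const _ _ hα]
    rfl
  · rw [coeff_of_notMem hα, coeff_of_notMem hα, mul_zero, mul_zero]
    rfl

/-- The action `D ↦ φ • D` as a map `HS^p_k(A; Δ) → HS^q_k(A; Ω)`; here `End_k(A)` is an algebra
over `A` through the multiplication operators. -/
def SubstMap.actHS (φ : SubstMap A Δ Ω) (D : HSDer k A Δ) : HSDer k A Ω :=
  ⟨φ.actUnits (Algebra.lmul k A).toRingHom D.1, by
    intro e he x y
    show coeff e (φ.bullet (Algebra.lmul k A).toRingHom (ser D.1)) (x * y) =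
      ∑ t ∈ antidiagonal e, coeff t.1 (φ.bullet (Algebra.lmul k A).toRingHom (ser D.1)) x *
        coeff t.2 (φ.bullet (Algebra.lmul k A).toRingHom (ser D.1)) y
    rw [φ.coeff_bullet_lmul _ _ he, const_mul, (isLeibniz_iff _).1 D.2, map_mul,
      coeff_mul _ _ he]
    refine Finset.sum_congr rfl fun t ht => ?_
    rw [φ.coeff_bullet_lmul _ _ (Coideal.fst_mem he ht),
      φ.coeff_bullet_lmul _ _ (Coideal.snd_mem he ht)]⟩

end Subst

/-! ### HS-structures, LR-admissible maps and filtrations -/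

section Structures

variable {k A R : Type*} [CommRing k] [CommRing A] [Algebra k A] [Ring R] [Algebra k R]

/-- `r ∈ U^p(R; Δ)` is a `D`-element if `r a = D̃(a) r` for all `a ∈ A[[s]]_Δ`. -/
def IsDElement (ι : A →ₐ[k] R) {p : ℕ} {Δ : Coideal p} (D : HSDer k A Δ)
    (r : OneUnits R Δ) : Prop :=
  ∀ a : TruncSeries A Δ,
    ser r * TruncSeries.map (ι : A →+ R) a =
      TruncSeries.map (ι : A →+ R) (tilde (ser D.1) a) * (ser r)

/-- HS-structures over `A/k` on a `k`-algebra `R` over `A` (with structure map `ι`). -/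
structure HSStructure (ι : A →ₐ[k] R) where
  /-- The group homomorphisms `Ψ^p_Δ : HS^p_k(A; Δ) → U^p(R; Δ)`. -/
  Psi : ∀ (p : ℕ) (Δ : Coideal p), HSDer k A Δ →* OneUnits R Δ
  leibniz : ∀ (p : ℕ) (Δ : Coideal p) (D : HSDer k A Δ), IsDElement ι D (Psi p Δ D)
  subst : ∀ (p q : ℕ) (Δ : Coideal p) (Ω : Coideal q) (φ : SubstMap A Δ Ω) (D : HSDer k A Δ),
    Psi q Ω (φ.actHS D) = φ.actUnits ι.toRingHom (Psi p Δ D)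

/-- LR-admissible maps `∇ : Der_k(A) → R`. -/
structure IsLRAdmissible (ι : A →ₐ[k] R) (nabla : Derivation k A A →+ R) : Prop where
  map_smul : ∀ (a : A) (δ : Derivation k A A), nabla (a • δ) = ι a * nabla δ
  leibniz : ∀ (δ : Derivation k A A) (a : A), nabla δ * ι a = ι a * nabla δ + ι (δ a)
  map_bracket : ∀ δ δ' : Derivation k A A,
    nabla ⁅δ, δ'⁆ = nabla δ * nabla δ' - nabla δ' * nabla δ

/-- `(F_d)_{d ≥ 0}` makes `R` a filtered `k`-algebra over `A`: it is an increasing exhaustive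
filtration by additive subgroups, compatible with products, with `ι(A) ⊆ F_0`. -/
structure IsAlgFiltration (ι : A →ₐ[k] R) (F : ℕ → AddSubgroup R) : Prop where
  mono : Monotone F
  one_mem : (1 : R) ∈ F 0
  mul_mem : ∀ (i j : ℕ) (x y : R), x ∈ F i → y ∈ F j → x * y ∈ F (i + j)
  exhaustive : ∀ x : R, ∃ d, x ∈ F d
  range_le : ∀ a : A, ι a ∈ F 0

/-- `U^p_fil(R; Δ)`: the elements `∑ r_α s^α` of `U^p(R; Δ)` with `r_α ∈ F_{|α|}`. -/
def filUnits (F : ℕ → AddSubgroup R) {p : ℕ} (Δ : Coideal p) : Set (OneUnits R Δ) :=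
  {r | ∀ α ∈ Δ.1, coeff α (ser r) ∈ F α.degree}

/-- An HS-structure is filtered if all `Ψ^p_Δ` take values in `U^p_fil(R; Δ)`. -/
def HSStructure.IsFiltered {ι : A →ₐ[k] R} (Ψ : HSStructure ι) (F : ℕ → AddSubgroup R) : Prop :=
  ∀ (p : ℕ) (Δ : Coideal p) (D : HSDer k A Δ), Ψ.Psi p Δ D ∈ filUnits F Δ

/-- Compatibility of `Ψ` with `∇` through the logarithmic derivatives: for all `p ≥ 1`, all
non-empty co-ideals `Δ` and all `D`, one has `ε(Ψ^p_Δ(D)) = ∇̄(ε(D))`. -/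
def HSStructure.IsCompatible {ι : A →ₐ[k] R} (Ψ : HSStructure ι)
    (nabla : Derivation k A A →+ R) : Prop :=
  ∀ (p : ℕ), 1 ≤ p → ∀ (Δ : Coideal p) (D : HSDer k A Δ),
    epsPlus (Ψ.Psi p Δ D) = mapPlus nabla (epsHS D)

end Structures

end

end HasseSchmidt

namespace HasseSchmidt

noncomputable section

open Finset.HasAntidiagonal (antidiagonal mem_antidiagonal)
open TruncSeries

/-! ### Division by positive integers, degrees of exponents, and cancellation of units. -/

section Divisible

variable {M : Type*} [AddCommGroup M] [Module ℚ M]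

/-! The Euler derivation `χ` multiplies the coefficient of `s^α` by `|α|`, which is invertible for
`α ≠ 0`. Hence, when `e` has no constant term, `χ r = r e` with `r_0 = 1` is a recursion on `|α|`
with exactly one solution. This gives the bijectivity of `ε` on units, forces `Ψ(D)` to be the unit
with `ε(Ψ(D)) = ∇̄(ε(D))`, and settles uniqueness.

The commutation rule `r a = D̃(a) r` holds because its defect satisfies a recursion of the same kind
with zero initial value (`mul_map_eq_of_euler_eq`). Applied to `End_k(A)` itself, the rule says that
the solution of `χ D = D δ` with `δ` a series of derivations is a Hasse-Schmidt derivation, whence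
the bijectivity of `ε` on `HS`.

For multiplicativity and substitutions, no formula for `ε(DE)` or `ε(φ • D)` is compared on the two
sides. Instead one works in `S = End_k(A) × R` with `L = {(δ, ∇δ)}`, the graph of `∇`. This is a
divisible additive subgroup, closed under brackets and under left multiplication by `A`. Since a
derivation is determined by its underlying endomorphism, `ε(r) = ∇̄(ε(D))` says exactly that `ε(D,
r)` has coefficients in `L`. It then suffices that the units with this property are stable: - under
products (`EpsMem.mul`), since `ε(r r') = r'⁻¹ ε(r) r' + ε(r')` and conjugation by `r'` preserves
`L`; - under substitutions (`epsMem_actUnits`), by the chain rule `χ(φ • r) = ∑ χ(φ(s_i)) (φ • ∂_i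
r)`, the fact that `r⁻¹ ∂_i r` has coefficients in `L`, and the commutation rule, which moves
scalars past `(φ • r)⁻¹`.

Both rest on `coeff_mem_of_euler_eq`: solutions of `χ f = g + [f, e]` stay in a divisible Lie
subgroup. -/

theorem nsmul_inv_smul {n : ℕ} (hn : n ≠ 0) (x : M) : n • ((n : ℚ)⁻¹ • x) = x := by
  rw [← Nat.cast_smul_eq_nsmul ℚ, smul_smul, mul_inv_cancel₀ (by exact_mod_cast hn), one_smul]

theorem eq_of_nsmul_eq {n : ℕ} (hn : n ≠ 0) {x y : M} (h : n • x = n • y) : x = y := by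
  have h1 := congrArg (fun z => (n : ℚ)⁻¹ • z) h
  simpa only [← Nat.cast_smul_eq_nsmul ℚ, smul_smul,
    inv_mul_cancel₀ (show (n : ℚ) ≠ 0 by exact_mod_cast hn), one_smul] using h1

end Divisible

section Degree

variable {p : ℕ}

theorem degree_add_of_mem {α : Fin p →₀ ℕ} {q : (Fin p →₀ ℕ) × (Fin p →₀ ℕ)}
    (hq : q ∈ antidiagonal α) : q.1.degree + q.2.degree = α.degree := by
  rw [← map_add, mem_antidiagonal.1 hq]

theorem degree_pos_of_ne {α : Fin p →₀ ℕ} (h : α ≠ 0) : 0 < α.degree :=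
  Nat.pos_of_ne_zero fun h0 => h ((Finsupp.degree_eq_zero_iff _).1 h0)

theorem degree_fst_lt {α : Fin p →₀ ℕ} {q : (Fin p →₀ ℕ) × (Fin p →₀ ℕ)}
    (hq : q ∈ antidiagonal α) (h : q.2 ≠ 0) : q.1.degree < α.degree := by
  have := degree_add_of_mem hq
  have := degree_pos_of_ne h
  omega

theorem degree_snd_lt {α : Fin p →₀ ℕ} {q : (Fin p →₀ ℕ) × (Fin p →₀ ℕ)}
    (hq : q ∈ antidiagonal α) (h : q.1 ≠ 0) : q.2.degree < α.degree := by
  have := degree_add_of_mem hq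
  have := degree_pos_of_ne h
  omega

theorem sum_antidiagonal_swap {M : Type*} [AddCommMonoid M] (α : Fin p →₀ ℕ)
    (f : (Fin p →₀ ℕ) → (Fin p →₀ ℕ) → M) :
    ∑ q ∈ antidiagonal α, f q.2 q.1 = ∑ q ∈ antidiagonal α, f q.1 q.2 := by
  refine Finset.sum_nbij' Prod.swap Prod.swap ?_ ?_ ?_ ?_ ?_ <;>
    simp [add_comm]

end Degree

theorem ser_injective {R : Type*} [Ring R] {p : ℕ} {Δ : Coideal p} :
    Function.Injective (ser : OneUnits R Δ → TruncSeries R Δ) :=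
  fun _ _ h => Subtype.ext (Units.ext h)

theorem coeff_zero_ser {R : Type*} [Ring R] {p : ℕ} {Δ : Coideal p} (r : OneUnits R Δ) :
    coeff 0 (ser r) = 1 := r.2

theorem ser_mul_left_cancel {R : Type*} [Ring R] {p : ℕ} {Δ : Coideal p} (r : OneUnits R Δ)
    {x y : TruncSeries R Δ} (h : ser r * x = ser r * y) : x = y := by
  rw [← one_mul x, ← one_mul y, ← ser_inv_mul r, mul_assoc, mul_assoc, h]

theorem eps_eq_of_mul_eq {R : Type*} [Ring R] {p : ℕ} {Δ : Coideal p} (r : OneUnits R Δ)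
    {x : TruncSeries R Δ} (h : ser r * x = euler (ser r)) : eps r = x :=
  ser_mul_left_cancel r (by rw [h, series_mul_eps])

/-! ### Bijectivity of the logarithmic derivative -/

section Exp

variable {S : Type*} [Ring S] [Module ℚ S] {p : ℕ} {Δ : Coideal p}

/-- The coefficients of the solution of `χ x = x e` with constant term `1`. -/
def expCoeff (e : TruncSeries S Δ) (α : Fin p →₀ ℕ) : S :=
  if α = 0 then 1 else (α.degree : ℚ)⁻¹ • ∑ q ∈ antidiagonal α,
    if _h : q.1.degree < α.degree then expCoeff e q.1 * coeff q.2 e else 0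
termination_by α.degree

theorem expCoeff_zero (e : TruncSeries S Δ) : expCoeff e 0 = 1 := by
  rw [expCoeff, if_pos rfl]

theorem euler_ofFun_expCoeff (e : TruncSeries S Δ) (he : coeff 0 e = 0) :
    euler (ofFun Δ (expCoeff e)) = ofFun Δ (expCoeff e) * e := by
  refine ext fun α hα => ?_
  rw [coeff_euler _ hα, coeff_mul _ _ hα, coeff_ofFun hα]
  by_cases h0 : α = 0
  · subst h0
    simp [he]
  · rw [expCoeff, if_neg h0, nsmul_inv_smul (degree_pos_of_ne h0).ne']
    refine Finset.sum_congr rfl fun q hq => ?_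
    rw [coeff_ofFun (Coideal.fst_mem hα hq)]
    -- The guard in `expCoeff`, needed for termination, discards only the pair with `q.2 = 0`, which
    -- contributes nothing because `e` has no constant term.
    split_ifs with h
    · rfl
    · have h2 : q.2 = 0 := by
        by_contra h2
        exact h (degree_fst_lt hq h2)
      rw [h2, he, mul_zero]

/-- Since `e` has no constant term, the coefficient of `x * e` at `α` involves only coefficients of
`x` of degree below `|α|`; dividing by `|α|` gives the induction. -/
theorem eq_of_euler_eq {e x y : TruncSeries S Δ} (he : coeff 0 e = 0)
    (h0 : coeff 0 x = coeff 0 y) (hx : euler x = x * e) (hy : euler y = y * e) : x = y := by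
  have key : ∀ n : ℕ, ∀ α ∈ Δ.1, α.degree = n → coeff α x = coeff α y := by
    intro n
    induction n using Nat.strong_induction_on with
    | _ n ih =>
      intro α hα hn
      by_cases hα0 : α = 0
      · rw [hα0, h0]
      refine eq_of_nsmul_eq (degree_pos_of_ne hα0).ne' ?_
      rw [← coeff_euler _ hα, ← coeff_euler _ hα, hx, hy, coeff_mul _ _ hα, coeff_mul _ _ hα]
      refine Finset.sum_congr rfl fun q hq => ?_
      by_cases h2 : q.2 = 0
      · rw [h2, he, mul_zero, mul_zero]
      · rw [ih _ (hn ▸ degree_fst_lt hq h2) _ (Coideal.fst_mem hα hq) rfl]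
  exact ext fun α hα => key _ α hα rfl

theorem eps_injective : Function.Injective (eps : OneUnits S Δ → TruncSeries S Δ) := by
  intro r r' h
  refine ser_injective (eq_of_euler_eq (coeff_zero_eps r) ?_ (series_mul_eps r).symm ?_)
  · rw [coeff_zero_ser, coeff_zero_ser]
  · rw [h, series_mul_eps]

theorem exists_eps_eq (e : TruncSeries S Δ) (he : coeff 0 e = 0) :
    ∃ r : OneUnits S Δ, eps r = e :=
  ⟨ofSer (ofFun Δ (expCoeff e)) (by rw [coeff_ofFun Δ.zero_mem, expCoeff_zero]),
    eps_eq_of_mul_eq _ (euler_ofFun_expCoeff e he).symm⟩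

theorem epsPlus_bijective : Function.Bijective (epsPlus : OneUnits S Δ → plus S Δ) := by
  constructor
  · intro r r' h
    exact eps_injective (congrArg Subtype.val h)
  · rintro ⟨e, he⟩
    obtain ⟨r, hr⟩ := exists_eps_eq e he
    exact ⟨r, Subtype.ext hr⟩

end Exp

/-! ### Monomials and order-continuous maps -/

section Adic

variable {p q p' : ℕ} {Δ : Coideal p} {Ω : Coideal q} {Ω' : Coideal p'}

/-- The monomial `c s^α` as an element of `R[[s]]_Δ`. -/
def mono {R : Type*} [Ring R] (Δ : Coideal p) (α : Fin p →₀ ℕ) (c : R) : TruncSeries R Δ :=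
  proj Δ (MvPowerSeries.monomial α c)

section Mono

variable {R : Type*} [Ring R]

theorem coeff_mono (α : Fin p →₀ ℕ) (c : R) {β : Fin p →₀ ℕ} (hβ : β ∈ Δ.1) :
    coeff β (mono Δ α c) = if β = α then c else 0 := by
  classical
  rw [mono, coeff_proj hβ]
  exact MvPowerSeries.coeff_monomial β α c

theorem coeff_mono_of_ne {α β : Fin p →₀ ℕ} (c : R) (h : β ≠ α) :
    coeff β (mono Δ α c) = 0 := by
  by_cases hβ : β ∈ Δ.1
  · rw [coeff_mono _ _ hβ, if_neg h]
  · exact coeff_of_notMem hβ _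

theorem mono_mul (α β : Fin p →₀ ℕ) (c d : R) :
    mono Δ α c * mono Δ β d = mono Δ (α + β) (c * d) :=
  congrArg (proj Δ) (MvPowerSeries.monomial_mul_monomial α β c d)

theorem mono_zero (c : R) : mono Δ 0 c = const Δ c := rfl

theorem sPow_eq_mono (α : Fin p →₀ ℕ) : (sPow Δ α : TruncSeries R Δ) = mono Δ α 1 := rfl

theorem mono_eq (α : Fin p →₀ ℕ) (c : R) : mono Δ α c = mono Δ α 1 * const Δ c := by
  rw [← mono_zero, mono_mul, add_zero, one_mul]

theorem mono_eq_zero {α : Fin p →₀ ℕ} (hα : α ∉ Δ.1) (c : R) : mono Δ α c = 0 :=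
  ext fun β hβ => by
    rw [coeff_mono_of_ne c (by rintro rfl; exact hα hβ), map_zero]

theorem coeff_mul_const (x : TruncSeries R Δ) (c : R) (α : Fin p →₀ ℕ) :
    coeff α (x * const Δ c) = coeff α x * c := by
  by_cases hα : α ∈ Δ.1
  · rw [coeff_mul _ _ hα, Finset.sum_eq_single (α, 0)]
    · rw [coeff_const _ Δ.zero_mem, if_pos rfl]
    · rintro ⟨b, d⟩ h hne
      rw [coeff_const _ (Coideal.snd_mem hα h), if_neg, mul_zero]
      rintro rfl
      simp only [mem_antidiagonal, add_zero] at h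
      exact hne (by rw [h])
    · intro h
      exact absurd (by simp) h
  · rw [coeff_of_notMem hα, coeff_of_notMem hα, zero_mul]

theorem coeff_const_mul (x : TruncSeries R Δ) (c : R) (α : Fin p →₀ ℕ) :
    coeff α (const Δ c * x) = c * coeff α x := by
  by_cases hα : α ∈ Δ.1
  · rw [coeff_mul _ _ hα, Finset.sum_eq_single (0, α)]
    · rw [coeff_const _ Δ.zero_mem, if_pos rfl]
    · rintro ⟨b, d⟩ h hne
      rw [coeff_const _ (Coideal.fst_mem hα h), if_neg, zero_mul]
      rintro rfl
      simp only [mem_antidiagonal, zero_add] at h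
      exact hne (by rw [h])
    · intro h
      exact absurd (by simp) h
  · rw [coeff_of_notMem hα, coeff_of_notMem hα, mul_zero]

/-- The monomials `s^α` are central. -/
theorem mono_one_mul_comm (α : Fin p →₀ ℕ) (x : TruncSeries R Δ) :
    mono Δ α 1 * x = x * mono Δ α 1 := by
  refine ext fun β hβ => ?_
  rw [coeff_mul _ _ hβ, coeff_mul _ _ hβ,
    ← sum_antidiagonal_swap β fun b c => coeff b (mono Δ α 1) * coeff c x]
  refine Finset.sum_congr rfl fun t ht => ?_
  by_cases h : t.2 = α
  · subst h
    simp [coeff_mono _ _ (Coideal.snd_mem hβ ht)]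
  · simp [coeff_mono_of_ne (1 : R) h]

end Mono

/-- `x` has order at least `n`. -/
def OrderGE {M : Type*} [AddCommGroup M] (n : ℕ) (x : TruncSeries M Δ) : Prop :=
  ∀ α, α.degree < n → coeff α x = 0

/-- Additive maps between truncated power series which are continuous for the order topology. -/
structure IsAdic {M N : Type*} [AddCommGroup M] [AddCommGroup N]
    (F : TruncSeries M Δ → TruncSeries N Ω) : Prop where
  add : ∀ x y, F (x + y) = F x + F y
  order : ∀ n, ∃ m, ∀ x, OrderGE m x → OrderGE n (F x)

namespace IsAdic

section Group

variable {M N P : Type*} [AddCommGroup M] [AddCommGroup N] [AddCommGroup P]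

theorem comp {G : TruncSeries N Ω → TruncSeries P Ω'} {F : TruncSeries M Δ → TruncSeries N Ω}
    (hG : IsAdic G) (hF : IsAdic F) : IsAdic fun x => G (F x) where
  add x y := by rw [hF.add, hG.add]
  order n := by
    obtain ⟨m, hm⟩ := hG.order n
    obtain ⟨l, hl⟩ := hF.order m
    exact ⟨l, fun x hx => hm _ (hl _ hx)⟩

theorem id : IsAdic fun x : TruncSeries M Δ => x where
  add _ _ := rfl
  order n := ⟨n, fun _ hx => hx⟩

theorem sub {F G : TruncSeries M Δ → TruncSeries N Ω} (hF : IsAdic F) (hG : IsAdic G) :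
    IsAdic fun x => F x - G x where
  add x y := by rw [hF.add, hG.add]; abel
  order n := by
    obtain ⟨m, hm⟩ := hF.order n
    obtain ⟨l, hl⟩ := hG.order n
    refine ⟨max m l, fun x hx e he => ?_⟩
    rw [map_sub, hm x (fun α hα => hx α (lt_of_lt_of_le hα (le_max_left _ _))) e he,
      hl x (fun α hα => hx α (lt_of_lt_of_le hα (le_max_right _ _))) e he, sub_zero]

theorem sum {ι : Type*} [Finite ι] (s : Finset ι) {F : ι → TruncSeries M Δ → TruncSeries N Ω}
    (hF : ∀ i, IsAdic (F i)) : IsAdic fun x => ∑ i ∈ s, F i x where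
  add x y := by simp only [(hF _).add, Finset.sum_add_distrib]
  order n := by
    choose m hm using fun i => (hF i).order n
    obtain ⟨b, hb⟩ := (Set.finite_range m).bddAbove
    refine ⟨b, fun x hx e he => ?_⟩
    rw [map_sum]
    exact Finset.sum_eq_zero fun i _ =>
      hm i x (fun α hα => hx α (lt_of_lt_of_le hα (hb ⟨i, rfl⟩))) e he

theorem map (f : M →+ N) : IsAdic (TruncSeries.map (Δ := Δ) f) where
  add := map_add _
  order n := ⟨n, fun x hx e he => by
    by_cases h : e ∈ Δ.1
    · rw [coeff_map f x h, hx e he, map_zero]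
    · exact coeff_of_notMem h _⟩

theorem euler : IsAdic (euler : TruncSeries M Δ → TruncSeries M Δ) where
  add x y := ext fun α hα => by
    rw [map_add, coeff_euler _ hα, coeff_euler _ hα, coeff_euler _ hα, map_add, smul_add]
  order n := ⟨n, fun x hx e he => by
    by_cases h : e ∈ Δ.1
    · rw [coeff_euler x h, hx e he, smul_zero]
    · exact coeff_of_notMem h _⟩

theorem map_zero {F : TruncSeries M Δ → TruncSeries N Ω} (hF : IsAdic F) : F 0 = 0 := by
  have := hF.add 0 0
  rwa [add_zero, left_eq_add] at this

end Group

section Ring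

variable {R N S : Type*} [Ring R] [AddCommGroup N] [Ring S]

theorem mul_left {F : TruncSeries N Δ → TruncSeries S Ω} (y : TruncSeries S Ω) (hF : IsAdic F) :
    IsAdic fun x => y * F x where
  add a b := by rw [hF.add, mul_add]
  order n := by
    obtain ⟨m, hm⟩ := hF.order n
    refine ⟨m, fun x hx e he => ?_⟩
    by_cases h : e ∈ Ω.1
    · rw [coeff_mul _ _ h]
      refine Finset.sum_eq_zero fun t ht => ?_
      have := degree_add_of_mem ht
      rw [hm x hx _ (by omega), mul_zero]
    · exact coeff_of_notMem h _

theorem mul_right {F : TruncSeries N Δ → TruncSeries S Ω} (y : TruncSeries S Ω)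
    (hF : IsAdic F) : IsAdic fun x => F x * y where
  add a b := by rw [hF.add, add_mul]
  order n := by
    obtain ⟨m, hm⟩ := hF.order n
    refine ⟨m, fun x hx e he => ?_⟩
    by_cases h : e ∈ Ω.1
    · rw [coeff_mul _ _ h]
      refine Finset.sum_eq_zero fun t ht => ?_
      have := degree_add_of_mem ht
      rw [hm x hx _ (by omega), zero_mul]
    · exact coeff_of_notMem h _

/-- By continuity, one coefficient of `F x` depends on finitely many coefficients of `x`: removing
from `x` its terms of degree at most `m` leaves a series whose image has order greater than `|e|`.
-/
theorem exists_coeff_eq_sum {F : TruncSeries R Δ → TruncSeries N Ω} (hF : IsAdic F)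
    (e : Fin q →₀ ℕ) : ∃ s : Finset (Fin p →₀ ℕ), ∀ x : TruncSeries R Δ,
      coeff e (F x) = ∑ α ∈ s, coeff e (F (mono Δ α (coeff α x))) := by
  classical
  let f : TruncSeries R Δ →+ TruncSeries N Ω := ⟨⟨F, hF.map_zero⟩, hF.add⟩
  obtain ⟨m, hm⟩ := hF.order (e.degree + 1)
  refine ⟨(finite_degree_le p m).toFinset, fun x => ?_⟩
  set s := (finite_degree_le p m).toFinset with hs
  have h : OrderGE m (x - ∑ α ∈ s, mono Δ α (coeff α x)) := fun β hβ => by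
    by_cases hΔ : β ∈ Δ.1
    · rw [map_sub, map_sum, Finset.sum_eq_single β]
      · rw [coeff_mono _ _ hΔ, if_pos rfl, sub_self]
      · intro α _ hα
        rw [coeff_mono_of_ne _ hα.symm]
      · intro h
        refine absurd ?_ h
        rw [hs, Set.Finite.mem_toFinset]
        exact hβ.le
    · exact coeff_of_notMem hΔ _
  have h1 : coeff e (f (x - ∑ α ∈ s, mono Δ α (coeff α x))) = 0 := hm _ h e (Nat.lt_succ_self _)
  rw [_root_.map_sub, _root_.map_sub, sub_eq_zero, map_sum, map_sum] at h1
  exact h1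

/-- Series are infinite sums of monomials, so additivity alone would not allow this reduction;
continuity supplies the rest. -/
theorem ext_mono {F G : TruncSeries R Δ → TruncSeries N Ω} (hF : IsAdic F) (hG : IsAdic G)
    (h : ∀ α c, F (mono Δ α c) = G (mono Δ α c)) (x : TruncSeries R Δ) : F x = G x := by
  rw [← sub_eq_zero]
  refine ext fun e _ => ?_
  obtain ⟨s, hs⟩ := (hF.sub hG).exists_coeff_eq_sum e
  rw [hs x, _root_.map_zero]
  exact Finset.sum_eq_zero fun α _ => by rw [h, sub_self, _root_.map_zero]

theorem coeff_mem {F : TruncSeries R Δ → TruncSeries N Ω} (hF : IsAdic F)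
    {K : AddSubgroup R} {L : AddSubgroup N}
    (h : ∀ α, ∀ c ∈ K, ∀ e, coeff e (F (mono Δ α c)) ∈ L) {x : TruncSeries R Δ}
    (hx : ∀ α, coeff α x ∈ K) (e : Fin q →₀ ℕ) : coeff e (F x) ∈ L := by
  obtain ⟨s, hs⟩ := hF.exists_coeff_eq_sum e
  rw [hs x]
  exact AddSubgroup.sum_mem _ fun α _ => h α _ (hx α) e

end Ring

end IsAdic

end Adic

/-! ### Units with logarithmic derivative in a Lie subring -/

/-- A divisible additive subgroup closed under commutators. -/
structure IsLieSubgroup {S : Type*} [Ring S] (L : AddSubgroup S) : Prop where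
  div : ∀ n : ℕ, n ≠ 0 → ∀ x : S, n • x ∈ L → x ∈ L
  bracket : ∀ x ∈ L, ∀ y ∈ L, x * y - y * x ∈ L

section Lie

variable {S : Type*} [Ring S] {p : ℕ} {Δ : Coideal p} {L : AddSubgroup S}

/-- Up to the factor `|α|`, the coefficient `f_α` is `g_α` plus brackets `[f_β, e_γ]` with `β + γ =
α`. Those with `γ = 0` vanish and the others have `|β| < |α|`, so induction and divisibility of `L`
apply. -/
theorem coeff_mem_of_euler_eq (hL : IsLieSubgroup L) {f g e : TruncSeries S Δ}
    (he0 : coeff 0 e = 0) (he : ∀ α, coeff α e ∈ L) (hg : ∀ α, coeff α g ∈ L)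
    (hf0 : coeff 0 f ∈ L) (hf : euler f = g + (f * e - e * f)) (α : Fin p →₀ ℕ) :
    coeff α f ∈ L := by
  have key : ∀ n : ℕ, ∀ α ∈ Δ.1, α.degree = n → coeff α f ∈ L := by
    intro n
    induction n using Nat.strong_induction_on with
    | _ n ih =>
      intro α hα hn
      by_cases hα0 : α = 0
      · rwa [hα0]
      refine hL.div _ (degree_pos_of_ne hα0).ne' _ ?_
      rw [← coeff_euler _ hα, hf, map_add, map_sub, coeff_mul _ _ hα, coeff_mul _ _ hα,
        ← sum_antidiagonal_swap α fun b c => coeff b e * coeff c f, ← Finset.sum_sub_distrib]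
      refine L.add_mem (hg α) (L.sum_mem fun q hq => ?_)
      by_cases h2 : q.2 = 0
      · rw [h2, he0, mul_zero, zero_mul, sub_zero]
        exact L.zero_mem
      · exact hL.bracket _ (ih _ (hn ▸ degree_fst_lt hq h2) _ (Coideal.fst_mem hα hq) rfl) _ (he _)
  by_cases hα : α ∈ Δ.1
  · exact key _ α hα rfl
  · rw [coeff_of_notMem hα]
    exact L.zero_mem

theorem coeff_mono_one_mul_mem {x : TruncSeries S Δ} (hx : ∀ α, coeff α x ∈ L)
    (β α : Fin p →₀ ℕ) : coeff α (mono Δ β 1 * x) ∈ L := by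
  by_cases hα : α ∈ Δ.1
  · rw [coeff_mul _ _ hα]
    refine L.sum_mem fun q hq => ?_
    rw [coeff_mono _ _ (Coideal.fst_mem hα hq)]
    split_ifs
    · rw [one_mul]
      exact hx _
    · rw [zero_mul]
      exact L.zero_mem
  · rw [coeff_of_notMem hα]
    exact L.zero_mem

theorem euler_const (c : S) : euler (const Δ c) = 0 :=
  ext fun α hα => by
    rw [coeff_euler _ hα, coeff_const _ hα, map_zero]
    split_ifs with h
    · rw [h, map_zero, zero_smul]
    · rw [smul_zero]

/-- The units `r` such that the coefficients of `ε(r)` belong to `L`. -/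
def EpsMem (L : AddSubgroup S) (r : OneUnits S Δ) : Prop :=
  ∀ α, coeff α (eps r) ∈ L

/-- Applying `χ` to `r f = c r`, where `f = r⁻¹ c r`, gives `χ f = [f, ε(r)]` with initial value
`f_0 = c`. -/
theorem EpsMem.conj_const_mem (hL : IsLieSubgroup L) {r : OneUnits S Δ} (hr : EpsMem L r) {c : S}
    (hc : c ∈ L) (α : Fin p →₀ ℕ) : coeff α (ser r⁻¹ * (const Δ c * ser r)) ∈ L := by
  obtain ⟨f, hf⟩ : ∃ f, f = ser r⁻¹ * (const Δ c * ser r) := ⟨_, rfl⟩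
  rw [← hf]
  have h1 : ser r * f = const Δ c * ser r := by
    rw [hf, ← mul_assoc, ser_mul_inv, one_mul]
  refine coeff_mem_of_euler_eq (g := 0) hL (coeff_zero_eps r) hr (fun α => ?_) ?_ ?_ α
  · rw [map_zero]
    exact L.zero_mem
  · rwa [hf, coeff_zero_mul, coeff_zero_mul, coeff_zero_ser, coeff_zero_ser, one_mul, mul_one,
      coeff_const _ Δ.zero_mem, if_pos rfl]
  · have h2 := congrArg euler h1
    rw [euler_mul, euler_mul, euler_const, zero_mul, zero_add, ← series_mul_eps r,
      ← mul_assoc, ← h1, mul_assoc, mul_assoc, ← mul_add] at h2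
    rw [zero_add, ← ser_mul_left_cancel r h2, add_sub_cancel_left]

/-- Conjugation is continuous and the monomials `s^β` are central, which reduces to the case of
constants. -/
theorem EpsMem.conj_mem (hL : IsLieSubgroup L) {r : OneUnits S Δ} (hr : EpsMem L r)
    {x : TruncSeries S Δ} (hx : ∀ α, coeff α x ∈ L) (α : Fin p →₀ ℕ) :
    coeff α (ser r⁻¹ * (x * ser r)) ∈ L := by
  refine ((IsAdic.id.mul_right (ser r)).mul_left (ser r⁻¹)).coeff_mem (K := L)
    (fun β c hc e => ?_) hx α
  rw [mono_eq, mul_assoc, ← mul_assoc, ← mono_one_mul_comm, mul_assoc]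
  exact coeff_mono_one_mul_mem (hr.conj_const_mem hL hc) β e

theorem eps_mul (r r' : OneUnits S Δ) :
    eps (r * r') = ser r'⁻¹ * (eps r * ser r') + eps r' := by
  refine eps_eq_of_mul_eq _ ?_
  rw [ser_mul, euler_mul, mul_add, mul_assoc, mul_assoc, ← mul_assoc (ser r') (ser r'⁻¹),
    ser_mul_inv, one_mul, series_mul_eps, ← mul_assoc, series_mul_eps]

theorem EpsMem.mul (hL : IsLieSubgroup L) {r r' : OneUnits S Δ} (hr : EpsMem L r)
    (hr' : EpsMem L r') : EpsMem L (r * r') := fun α => by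
  rw [eps_mul, map_add]
  exact L.add_mem (hr'.conj_mem hL hr α) (hr' α)

end Lie

/-! ### The commutation rule for exponentials -/

section DElement

variable {k A S : Type*} [CommRing k] [CommRing A] [Algebra k A] [Ring S] [Algebra k S]
  {p : ℕ} {Δ : Coideal p}

theorem map_mono (ι : A →ₐ[k] S) (α : Fin p →₀ ℕ) (c : A) :
    TruncSeries.map (ι : A →+ S) (mono Δ α c) = mono Δ α (ι c) :=
  ext fun β hβ => by
    rw [coeff_map _ _ hβ, coeff_mono _ _ hβ, coeff_mono _ _ hβ]
    split_ifs
    · rfl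
    · exact map_zero _

theorem map_const (ι : A →ₐ[k] S) (c : A) :
    TruncSeries.map (ι : A →+ S) (const Δ c) = const Δ (ι c) :=
  map_mono ι 0 c

theorem map_mul' (ι : A →ₐ[k] S) (x y : TruncSeries A Δ) :
    TruncSeries.map (ι : A →+ S) (x * y) =
      TruncSeries.map (ι : A →+ S) x * TruncSeries.map (ι : A →+ S) y :=
  ext fun α hα => by
    rw [coeff_map _ _ hα, coeff_mul _ _ hα, coeff_mul _ _ hα, map_sum]
    refine Finset.sum_congr rfl fun q hq => ?_
    rw [coeff_map _ _ (Coideal.fst_mem hα hq), coeff_map _ _ (Coideal.snd_mem hα hq)]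
    exact map_mul ι _ _

theorem euler_map (ι : A →ₐ[k] S) (x : TruncSeries A Δ) :
    euler (TruncSeries.map (ι : A →+ S) x) = TruncSeries.map (ι : A →+ S) (euler x) :=
  ext fun α hα => by
    rw [coeff_euler _ hα, coeff_map _ _ hα, coeff_map _ _ hα, coeff_euler _ hα, map_nsmul]

theorem isAdic_tilde (r : EndSeries k A Δ) : IsAdic (tilde r) where
  add := tilde_add r
  order n := ⟨n, fun x hx e he => by
    by_cases h : e ∈ Δ.1
    · rw [coeff_tilde _ _ h]
      refine Finset.sum_eq_zero fun t ht => ?_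
      have := degree_add_of_mem ht
      rw [hx _ (by omega), map_zero]
    · exact coeff_of_notMem h _⟩

theorem tilde_mono (r : EndSeries k A Δ) (β : Fin p →₀ ℕ) (c : A) :
    tilde r (mono Δ β c) = mono Δ β 1 * tilde r (const Δ c) :=
  ext fun α hα => by
    rw [coeff_tilde _ _ hα, coeff_mul _ _ hα,
      ← sum_antidiagonal_swap α fun b d => coeff b (mono Δ β 1) * coeff d (tilde r (const Δ c))]
    refine Finset.sum_congr rfl fun q hq => ?_
    rw [coeff_tilde_const _ _ (Coideal.fst_mem hα hq), coeff_mono _ _ (Coideal.snd_mem hα hq),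
      coeff_mono _ _ (Coideal.snd_mem hα hq)]
    split_ifs
    · rw [one_mul]
    · rw [map_zero, zero_mul]

variable (k A) in
/-- The inclusion of `Der_k(A)` into `End_k(A)`. -/
def derivToEnd : Derivation k A A →+ Module.End k A where
  toFun δ := (δ : A →ₗ[k] A)
  map_zero' := rfl
  map_add' _ _ := rfl

variable (k A) in
-- Seeing the inclusion of derivations as an LR-admissible map lets the commutation rule for `R`
-- also prove the Leibniz identities in `End_k(A)`, and lets `∇` be paired with it in `End_k(A) ×
-- R`.
theorem isLRAdmissible_derivToEnd : IsLRAdmissible (Algebra.lmul k A) (derivToEnd k A) where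
  map_smul a δ := rfl
  leibniz δ a := by
    ext b
    show δ (a * b) = a * δ b + δ a * b
    rw [δ.leibniz, smul_eq_mul, smul_eq_mul, mul_comm b]
  map_bracket δ δ' := by
    ext b
    show ⁅δ, δ'⁆ b = δ (δ' b) - δ' (δ b)
    rw [Derivation.commutator_apply]

/-- The defect of the commutation rule for `r`, as a function of the scalar series. -/
def commDefect (ι : A →ₐ[k] S) (r : TruncSeries S Δ) (D : EndSeries k A Δ)
    (a : TruncSeries A Δ) : TruncSeries S Δ :=
  r * TruncSeries.map (ι : A →+ S) a - TruncSeries.map (ι : A →+ S) (tilde D a) * r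

theorem isAdic_commDefect (ι : A →ₐ[k] S) (r : TruncSeries S Δ) (D : EndSeries k A Δ) :
    IsAdic (commDefect ι r D) :=
  ((IsAdic.map (ι : A →+ S)).mul_left r).sub
    (((IsAdic.map (ι : A →+ S)).comp (isAdic_tilde D)).mul_right r)

theorem commDefect_mono (ι : A →ₐ[k] S) (r : TruncSeries S Δ) (D : EndSeries k A Δ)
    (β : Fin p →₀ ℕ) (c : A) :
    commDefect ι r D (mono Δ β c) = mono Δ β 1 * commDefect ι r D (const Δ c) := by
  rw [commDefect, commDefect, tilde_mono, map_mul', mono_eq, map_mul', map_mono, map_one, mul_sub,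
    ← mul_assoc, ← mono_one_mul_comm, mul_assoc, mul_assoc]

theorem commDefect_eq_zero {ι : A →ₐ[k] S} {r : TruncSeries S Δ} {D : EndSeries k A Δ}
    (h : ∀ c, commDefect ι r D (const Δ c) = 0) (a : TruncSeries A Δ) :
    commDefect ι r D a = 0 := by
  refine ext fun e _ => ?_
  obtain ⟨s, hs⟩ := (isAdic_commDefect ι r D).exists_coeff_eq_sum e
  rw [hs, map_zero]
  refine Finset.sum_eq_zero fun α _ => ?_
  rw [commDefect_mono, h, mul_zero, map_zero]

/-- For constant `c`, the defect `E(c) = r c - D̃(c) r` satisfies `χ E(c) = E(c) N(δ) + E(δ̃(c))`.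
Both terms involve only defects of constants in lower degree, because `δ` has no constant term; so
`E` vanishes by induction on the degree, simultaneously for all `c`. -/
theorem mul_map_eq_of_euler_eq [Module ℚ S] {ι : A →ₐ[k] S} {N : Derivation k A A →+ S}
    (hN : ∀ (δ : Derivation k A A) (a : A), N δ * ι a = ι a * N δ + ι (δ a))
    {r : TruncSeries S Δ} {D : EndSeries k A Δ} {δ : TruncSeries (Derivation k A A) Δ}
    (hδ : coeff 0 δ = 0) (hr0 : coeff 0 r = 1) (hD0 : coeff 0 D = 1)
    (hr : euler r = r * TruncSeries.map N δ)
    (hD : euler D = D * TruncSeries.map (derivToEnd k A) δ) (a : TruncSeries A Δ) :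
    r * TruncSeries.map (ι : A →+ S) a = TruncSeries.map (ι : A →+ S) (tilde D a) * r := by
  have hcomm : ∀ c : A, TruncSeries.map N δ * TruncSeries.map (ι : A →+ S) (const Δ c) =
      TruncSeries.map (ι : A →+ S) (const Δ c) * TruncSeries.map N δ +
        TruncSeries.map (ι : A →+ S)
          (tilde (TruncSeries.map (derivToEnd k A) δ) (const Δ c)) := fun c =>
    ext fun α hα => by
      rw [map_const, coeff_mul_const, map_add, coeff_const_mul, coeff_map _ _ hα,
        coeff_map _ _ hα, coeff_tilde_const _ _ hα, coeff_map _ _ hα]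
      exact hN _ _
  have heuler : ∀ c : A, euler (commDefect ι r D (const Δ c)) =
      commDefect ι r D (const Δ c) * TruncSeries.map N δ +
        commDefect ι r D (tilde (TruncSeries.map (derivToEnd k A) δ) (const Δ c)) := fun c => by
    have hsub : ∀ x y : TruncSeries S Δ, euler (x - y) = euler x - euler y := fun x y => by
      rw [eq_sub_iff_add_eq, ← IsAdic.euler.add, sub_add_cancel]
    rw [commDefect, hsub, euler_mul, euler_mul, euler_map, euler_map, euler_const, tilde_euler,
      euler_const, (isAdic_tilde D).map_zero, map_zero, mul_zero, add_zero, add_zero, hr, hD,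
      tilde_mul, mul_assoc, hcomm, commDefect]
    noncomm_ring
  have key : ∀ n : ℕ, ∀ α ∈ Δ.1, α.degree = n → ∀ c,
      coeff α (commDefect ι r D (const Δ c)) = 0 := by
    intro n
    induction n using Nat.strong_induction_on with
    | _ n ih =>
      intro α hα hn c
      by_cases hα0 : α = 0
      · subst hα0
        rw [commDefect, map_sub, coeff_zero_mul, coeff_zero_mul, hr0, coeff_map _ _ hα,
          coeff_map _ _ hα, coeff_tilde_const _ _ hα, hD0, coeff_const _ hα, if_pos rfl, one_mul,
          mul_one]
        exact sub_self _
      refine eq_of_nsmul_eq (degree_pos_of_ne hα0).ne' ?_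
      rw [smul_zero, ← coeff_euler _ hα, heuler, map_add, coeff_mul _ _ hα,
        Finset.sum_eq_zero, zero_add]
      -- Here `δ̃(c)` is expanded in monomials: the `β = 0` term is zero since `δ_0 = 0`, and for `β
      -- ≠ 0` the factor `s^β` leaves a constant's defect in degree below `|α|`.
      · obtain ⟨s, hs⟩ := (isAdic_commDefect ι r D).exists_coeff_eq_sum α
        rw [hs]
        refine Finset.sum_eq_zero fun β _ => ?_
        rw [commDefect_mono, coeff_mul _ _ hα]
        by_cases hβ : β = 0
        · rw [hβ, coeff_tilde_const _ _ Δ.zero_mem, coeff_map _ _ Δ.zero_mem, hδ, map_zero,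
            LinearMap.zero_apply, ← mono_zero, commDefect_mono, ← mono_zero (Δ := Δ) (0 : A)]
          have h0 : mono Δ 0 (0 : A) = 0 := by rw [mono, map_zero, map_zero]
          rw [h0, (isAdic_commDefect ι r D).map_zero, mul_zero]
          exact Finset.sum_eq_zero fun q _ => by rw [map_zero, mul_zero]
        · refine Finset.sum_eq_zero fun q hq => ?_
          by_cases h1 : q.1 = 0
          · rw [coeff_mono_of_ne _ (h1 ▸ Ne.symm hβ), zero_mul]
          · rw [ih _ (hn ▸ degree_snd_lt hq h1) _ (Coideal.snd_mem hα hq) rfl, mul_zero]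
      · intro q hq
        by_cases h2 : q.2 = 0
        · rw [coeff_map _ _ (Coideal.snd_mem hα hq), h2, hδ, map_zero, mul_zero]
        · rw [ih _ (hn ▸ degree_fst_lt hq h2) _ (Coideal.fst_mem hα hq) rfl, zero_mul]
  exact sub_eq_zero.1 (commDefect_eq_zero (fun c => ext fun α hα => by
    rw [key _ α hα rfl c, map_zero]) a)

/-- With `S = End_k(A)` and `r = D`, the commutation rule reads `D ∘ x = D̃(x) ∘ D` as operators;
evaluating at `y` gives the Leibniz identities. -/
theorem isLeibniz_of_euler_eq [Module ℚ (Module.End k A)] {D : EndSeries k A Δ}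
    {δ : TruncSeries (Derivation k A A) Δ} (hδ : coeff 0 δ = 0) (hD0 : coeff 0 D = 1)
    (hD : euler D = D * TruncSeries.map (derivToEnd k A) δ) : IsLeibniz D := by
  intro α hα x y
  have h := congrArg (coeff α)
    (mul_map_eq_of_euler_eq (isLRAdmissible_derivToEnd k A).leibniz hδ hD0 hD0 hD hD (const Δ x))
  rw [map_const, coeff_mul_const, coeff_mul _ _ hα] at h
  have h1 := congrArg (fun f : Module.End k A => f y) h
  rw [LinearMap.sum_apply] at h1
  refine h1.trans (Finset.sum_congr rfl fun q hq => ?_)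
  rw [coeff_map _ _ (Coideal.fst_mem hα hq), coeff_tilde_const _ _ (Coideal.fst_mem hα hq)]
  rfl

theorem map_derivToEnd_epsHS (D : HSDer k A Δ) :
    TruncSeries.map (derivToEnd k A) (epsHS D).1 = eps D.1 :=
  ext fun α hα => by
    rw [coeff_map _ _ hα]
    exact coeff_epsHS D hα

theorem coeff_zero_epsHS (D : HSDer k A Δ) : coeff 0 (epsHS D).1 = 0 :=
  AddMonoidHom.mem_ker.1 (epsHS D).2

theorem derivToEnd_injective : Function.Injective (derivToEnd k A) := fun _ _ h =>
  Derivation.coe_injective (congrArg (fun f : Module.End k A => (f : A → A)) h)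

theorem epsHS_eq_of_eps_eq {D : HSDer k A Δ} {δ : plus (Derivation k A A) Δ}
    (h : eps D.1 = TruncSeries.map (derivToEnd k A) δ.1) : epsHS D = δ := by
  refine Subtype.ext (ext fun α hα => derivToEnd_injective ?_)
  rw [← coeff_map _ _ hα, ← coeff_map _ _ hα, map_derivToEnd_epsHS, h]

theorem epsHS_bijective [Module ℚ (Module.End k A)] :
    Function.Bijective (epsHS : HSDer k A Δ → plus (Derivation k A A) Δ) := by
  constructor
  · intro D E h
    refine Subtype.ext (eps_injective ?_)
    rw [← map_derivToEnd_epsHS, ← map_derivToEnd_epsHS, h]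
  · intro δ
    have h0 : coeff 0 δ.1 = 0 := AddMonoidHom.mem_ker.1 δ.2
    obtain ⟨r, hr⟩ := exists_eps_eq (TruncSeries.map (derivToEnd k A) δ.1)
      (by rw [coeff_map _ _ Δ.zero_mem, h0, map_zero])
    exact ⟨⟨r, isLeibniz_of_euler_eq h0 (coeff_zero_ser r) (by rw [← hr, series_mul_eps])⟩,
      epsHS_eq_of_eps_eq hr⟩

/-- Exponentials satisfy the commutation rule. -/
theorem isDElement_of_eps_eq [Module ℚ S] {ι : A →ₐ[k] S} {N : Derivation k A A →+ S}
    (hN : ∀ (δ : Derivation k A A) (a : A), N δ * ι a = ι a * N δ + ι (δ a))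
    {D : HSDer k A Δ} {r : OneUnits S Δ} (h : eps r = TruncSeries.map N (epsHS D).1) :
    IsDElement ι D r :=
  mul_map_eq_of_euler_eq hN (coeff_zero_epsHS D) (coeff_zero_ser r) (coeff_zero_ser D.1)
    (by rw [← h, series_mul_eps]) (by rw [map_derivToEnd_epsHS, series_mul_eps])

end DElement

/-! ### Partial derivatives -/

section PartialDerivatives

variable {S : Type*} [Ring S] {p : ℕ} {Δ : Coideal p}

/-- The derivation `s_i ∂/∂s_i`. -/
def partialEuler (i : Fin p) (x : TruncSeries S Δ) : TruncSeries S Δ :=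
  ofFun Δ fun α => α i • coeff α x

theorem coeff_partialEuler (i : Fin p) (x : TruncSeries S Δ) {α : Fin p →₀ ℕ} (hα : α ∈ Δ.1) :
    coeff α (partialEuler i x) = α i • coeff α x :=
  coeff_ofFun hα _

theorem partialEuler_mul (i : Fin p) (x y : TruncSeries S Δ) :
    partialEuler i (x * y) = partialEuler i x * y + x * partialEuler i y := by
  refine ext fun α hα => ?_
  rw [map_add, coeff_partialEuler _ _ hα, coeff_mul _ _ hα, coeff_mul _ _ hα, coeff_mul _ _ hα,
    Finset.smul_sum, ← Finset.sum_add_distrib]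
  refine Finset.sum_congr rfl fun q hq => ?_
  rw [coeff_partialEuler _ _ (Coideal.fst_mem hα hq),
    coeff_partialEuler _ _ (Coideal.snd_mem hα hq),
    smul_mul_assoc, mul_smul_comm, ← add_smul, ← Finsupp.add_apply, mem_antidiagonal.1 hq]

theorem euler_partialEuler (i : Fin p) (x : TruncSeries S Δ) :
    euler (partialEuler i x) = partialEuler i (euler x) :=
  ext fun α hα => by
    rw [coeff_euler _ hα, coeff_partialEuler _ _ hα, coeff_partialEuler _ _ hα, coeff_euler _ hα,
      smul_comm]

/-- The partial derivative `∂/∂s_i` (coefficients outside of `Δ` are read as zero). -/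
def partialDeriv (i : Fin p) (x : TruncSeries S Δ) : TruncSeries S Δ :=
  ofFun Δ fun α => (α i + 1) • coeff (α + Finsupp.single i 1) x

theorem coeff_partialDeriv (i : Fin p) (x : TruncSeries S Δ) {α : Fin p →₀ ℕ} (hα : α ∈ Δ.1) :
    coeff α (partialDeriv i x) = (α i + 1) • coeff (α + Finsupp.single i 1) x :=
  coeff_ofFun hα _

theorem isAdic_partialDeriv (i : Fin p) :
    IsAdic (partialDeriv i : TruncSeries S Δ → TruncSeries S Δ) where
  add x y := ext fun α hα => by
    rw [map_add, coeff_partialDeriv _ _ hα, coeff_partialDeriv _ _ hα, coeff_partialDeriv _ _ hα,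
      map_add, smul_add]
  order n := ⟨n + 1, fun x hx e he => by
    by_cases h : e ∈ Δ.1
    · rw [coeff_partialDeriv _ _ h, hx, smul_zero]
      rw [map_add, Finsupp.degree_single]
      omega
    · exact coeff_of_notMem h _⟩

theorem coeff_mono_one_mul_add {α β : Fin p →₀ ℕ} (h : α + β ∈ Δ.1) (x : TruncSeries S Δ) :
    coeff (α + β) (mono Δ β 1 * x) = coeff α x := by
  rw [coeff_mul _ _ h, Finset.sum_eq_single (β, α)]
  · rw [coeff_mono _ _ (Δ.1.lower le_add_self h), if_pos rfl, one_mul]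
  · rintro ⟨b, c⟩ hq hne
    rw [coeff_mono_of_ne, zero_mul]
    intro hb
    change b = β at hb
    have hc : c = α := by
      have := mem_antidiagonal.1 hq
      rw [hb, add_comm α] at this
      exact add_left_cancel this
    exact hne (by rw [hb, hc])
  · intro hq
    exact absurd (mem_antidiagonal.2 (add_comm β α)) hq

theorem coeff_mono_one_mul_of_not_le {α β : Fin p →₀ ℕ} (h : ¬ β ≤ α) (x : TruncSeries S Δ) :
    coeff α (mono Δ β 1 * x) = 0 := by
  by_cases hα : α ∈ Δ.1
  · rw [coeff_mul _ _ hα]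
    refine Finset.sum_eq_zero fun q hq => ?_
    rw [coeff_mono_of_ne, zero_mul]
    rintro rfl
    exact h (by rw [← mem_antidiagonal.1 hq]; exact le_self_add)
  · exact coeff_of_notMem hα _

theorem mono_single_mul_partialDeriv (i : Fin p) (x : TruncSeries S Δ) :
    mono Δ (Finsupp.single i 1) 1 * partialDeriv i x = partialEuler i x := by
  refine ext fun α hα => ?_
  rw [coeff_partialEuler _ _ hα]
  by_cases h : Finsupp.single i 1 ≤ α
  · obtain ⟨β, rfl⟩ := le_iff_exists_add.1 h
    rw [add_comm] at hα ⊢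
    rw [coeff_mono_one_mul_add hα, coeff_partialDeriv _ _ (Δ.1.lower le_self_add hα)]
    simp
  · rw [coeff_mono_one_mul_of_not_le h]
    rw [Finsupp.single_le_iff] at h
    rw [show α i = 0 by omega, zero_smul]

/-- The condition `α ∈ Δ` matters: otherwise the left side is zero while `α - e_i` may still lie in
`Δ`. If `α i = 0`, the truncated subtraction is harmless because the coefficient is zero. -/
theorem partialDeriv_mono (i : Fin p) (α : Fin p →₀ ℕ) (hα : α ∈ Δ.1) (c : S) :
    partialDeriv i (mono Δ α c) = mono Δ (α - Finsupp.single i 1) (α i • c) := by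
  refine ext fun β hβ => ?_
  rw [coeff_partialDeriv _ _ hβ, coeff_mono _ _ hβ]
  by_cases h : β + Finsupp.single i 1 = α
  · rw [h, coeff_mono _ _ hα, if_pos rfl, ← h, if_pos (by simp)]
    simp
  · rw [coeff_mono_of_ne _ h, smul_zero]
    split_ifs with h1
    · have h2 : α i = 0 := by
        by_contra h2
        refine h ?_
        rw [h1, tsub_add_cancel_of_le (Finsupp.single_le_iff.2 (by omega))]
      rw [h2, zero_smul]
    · rfl

/-- The derivations `χ` and `θ = s_i ∂/∂s_i` commute. Applying `χ` to `r f = θ r` therefore gives `χ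
f = θ(ε(r)) + [f, ε(r)]`. -/
theorem EpsMem.inv_mul_partialEuler_mem {L : AddSubgroup S} (hL : IsLieSubgroup L)
    {r : OneUnits S Δ} (hr : EpsMem L r) (i : Fin p) (α : Fin p →₀ ℕ) :
    coeff α (ser r⁻¹ * partialEuler i (ser r)) ∈ L := by
  obtain ⟨f, hf⟩ : ∃ f, f = ser r⁻¹ * partialEuler i (ser r) := ⟨_, rfl⟩
  rw [← hf]
  have h1 : ser r * f = partialEuler i (ser r) := by
    rw [hf, ← mul_assoc, ser_mul_inv, one_mul]
  refine coeff_mem_of_euler_eq (g := partialEuler i (eps r)) hL (coeff_zero_eps r) hr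
    (fun β => ?_) ?_ ?_ α
  · by_cases hβ : β ∈ Δ.1
    · rw [coeff_partialEuler _ _ hβ]
      exact L.nsmul_mem (hr β) _
    · rw [coeff_of_notMem hβ]
      exact L.zero_mem
  · rw [hf, coeff_zero_mul, coeff_partialEuler _ _ Δ.zero_mem, Finsupp.zero_apply, zero_smul,
      mul_zero]
    exact L.zero_mem
  · have h2 := congrArg euler h1
    rw [euler_mul, euler_partialEuler, ← series_mul_eps r, partialEuler_mul, ← h1, mul_assoc,
      mul_assoc, ← mul_add, ← mul_add] at h2
    have h3 := ser_mul_left_cancel r h2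
    rw [eq_sub_of_add_eq' h3]
    abel

/-- The co-ideal `ℕ^p`. -/
def topCoideal (p : ℕ) : Coideal p := ⟨⊤, ⟨0, trivial⟩⟩

theorem mem_topCoideal (α : Fin p →₀ ℕ) : α ∈ (topCoideal p).1 := trivial

/-- Multiplication by `s_i` turns `∂_i` into `s_i ∂_i` and shifts exponents by `e_i`. The shifted
exponent must remain in the co-ideal, hence the restriction to untruncated series. -/
theorem EpsMem.inv_mul_partialDeriv_mem {L : AddSubgroup S} (hL : IsLieSubgroup L)
    {r : OneUnits S (topCoideal p)} (hr : EpsMem L r) (i : Fin p) (α : Fin p →₀ ℕ) :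
    coeff α (ser r⁻¹ * partialDeriv i (ser r)) ∈ L := by
  rw [← coeff_mono_one_mul_add (mem_topCoideal (α + Finsupp.single i 1)), ← mul_assoc,
    mono_one_mul_comm, mul_assoc, mono_single_mul_partialDeriv]
  exact hr.inv_mul_partialEuler_mem hL i _

end PartialDerivatives

/-! ### The action of substitution maps -/

instance {A : Type*} [CommRing A] {p : ℕ} (Δ : Coideal p) : CommRing (TruncSeries A Δ) :=
  { instRing A Δ with
    mul_comm := fun x y => ext fun α hα => by
      refine (coeff_mul x y hα).trans (Eq.trans ?_ (coeff_mul y x hα).symm)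
      rw [← sum_antidiagonal_swap α fun b c => coeff b x * coeff c y]
      exact Finset.sum_congr rfl fun _ _ => mul_comm _ _ }

section Bullet

variable {k A S : Type*} [CommRing k] [CommRing A] [Algebra k A] [Ring S] [Algebra k S]
  {p q : ℕ} {Δ : Coideal p} {Ω : Coideal q} (φ : SubstMap A Δ Ω)

theorem isAdic_bullet (ι : A →+* S) : IsAdic (φ.bullet ι) where
  add x y := ext fun e he => by
    rw [map_add, φ.coeff_bullet _ _ he, φ.coeff_bullet _ _ he, φ.coeff_bullet _ _ he,
      ← Finset.sum_add_distrib]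
    exact Finset.sum_congr rfl fun α _ => by rw [map_add, mul_add]
  order n := ⟨n, fun x hx e he => by
    by_cases h : e ∈ Ω.1
    · rw [φ.coeff_bullet _ _ h]
      refine Finset.sum_eq_zero fun α hα => ?_
      rw [Set.Finite.mem_toFinset] at hα
      rw [hx α (lt_of_le_of_lt hα he), mul_zero]
    · exact coeff_of_notMem h _⟩

theorem isAdic_toAlgHom : IsAdic φ.toAlgHom where
  add := map_add _
  order n := ⟨n, fun x hx e he => by
    obtain ⟨m, hm⟩ : ∃ m : MvPowerSeries (Fin p) A, m = fun α => coeff α x := ⟨_, rfl⟩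
    have hf : proj Δ m = x := ext fun α hα => by rw [coeff_proj hα, hm]
    rw [← hf]
    exact φ.coeff_eq_zero n m (fun α hα => by rw [hm]; exact hx α hα) e he⟩

theorem toAlgHom_mono (α : Fin p →₀ ℕ) (c : A) :
    φ.toAlgHom (mono Δ α c) = φ.toAlgHom (mono Δ α 1) * const Ω c := by
  rw [mono_eq, map_mul]
  congr 1
  exact φ.toAlgHom.commutes c

theorem bullet_mono (ι : A →ₐ[k] S) (α : Fin p →₀ ℕ) (c : S) :
    φ.bullet ι.toRingHom (mono Δ α c) =
      TruncSeries.map (ι : A →+ S) (φ.toAlgHom (mono Δ α 1)) * const Ω c := by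
  by_cases hα : α ∈ Δ.1
  · refine ext fun e he => ?_
    rw [φ.coeff_bullet _ _ he, coeff_mul_const, coeff_map _ _ he, Finset.sum_eq_single α]
    · rw [coeff_mono _ _ hα, if_pos rfl]
      rfl
    · intro β _ hβ
      rw [coeff_mono_of_ne _ hβ, mul_zero]
    · intro h
      rw [Set.Finite.mem_toFinset] at h
      rw [φ.coeff_sPow_eq_zero (not_le.1 h), map_zero, zero_mul]
  · rw [mono_eq_zero hα, mono_eq_zero hα, (isAdic_bullet φ _).map_zero, map_zero, map_zero,
      zero_mul]

theorem bullet_mul_const (ι : A →+* S) (x : TruncSeries S Δ) (c : S) :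
    φ.bullet ι (x * const Δ c) = φ.bullet ι x * const Ω c :=
  ext fun e he => by
    rw [coeff_mul_const, φ.coeff_bullet _ _ he, φ.coeff_bullet _ _ he, Finset.sum_mul]
    exact Finset.sum_congr rfl fun α _ => by rw [coeff_mul_const, mul_assoc]

/-- The coefficients of `φ(s^α)` act on the left, so `φ •` is semilinear over `φ` for scalar series
on the left, without being multiplicative in general. Continuity in both arguments reduces to
monomials. -/
theorem bullet_map_mul (ι : A →ₐ[k] S) (a : TruncSeries A Δ) (x : TruncSeries S Δ) :
    φ.bullet ι.toRingHom (TruncSeries.map (ι : A →+ S) a * x) =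
      TruncSeries.map (ι : A →+ S) (φ.toAlgHom a) * φ.bullet ι.toRingHom x := by
  refine IsAdic.ext_mono ((isAdic_bullet φ _).comp ((IsAdic.map _).mul_right x))
    (((IsAdic.map _).comp (isAdic_toAlgHom φ)).mul_right _) (fun α b => ?_) a
  refine IsAdic.ext_mono ((isAdic_bullet φ _).comp (IsAdic.id.mul_left _))
    ((isAdic_bullet φ ι.toRingHom).mul_left _) (fun β c => ?_) x
  have key : φ.toAlgHom (mono Δ α b) * φ.toAlgHom (mono Δ β 1) =
      φ.toAlgHom (mono Δ (α + β) 1) * const Ω b := by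
    rw [toAlgHom_mono φ α b, mul_right_comm, ← map_mul, mono_mul, one_mul]
  rw [map_mono, mono_mul, bullet_mono, bullet_mono, const_mul, ← mul_assoc, ← mul_assoc,
    ← map_const, ← map_mul', ← map_mul', key]

/-- For a constant `c`, `(φ • r) c = φ • (r c) = φ • (D̃(c) r) = φ(D̃(c)) (φ • r)`, and `φ(D̃(c))`
is the value at `c` of the operator attached to `φ • D`. -/
theorem IsDElement.actUnits {ι : A →ₐ[k] S} {D : HSDer k A Δ} {r : OneUnits S Δ}
    (h : IsDElement ι D r) : IsDElement ι (φ.actHS D) (φ.actUnits ι.toRingHom r) := fun a => by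
  refine sub_eq_zero.1 (commDefect_eq_zero (r := ser (φ.actUnits ι.toRingHom r)) (fun c => ?_) a)
  have hφ : tilde (ser (φ.actHS D).1) (const Ω c) = φ.toAlgHom (tilde (ser D.1) (const Δ c)) :=
    ext fun e he => by
      rw [coeff_tilde_const _ _ he]
      exact φ.coeff_bullet_lmul _ _ he
  refine sub_eq_zero.2 ?_
  rw [hφ]
  show φ.bullet ι.toRingHom (ser r) * _ = _ * φ.bullet ι.toRingHom (ser r)
  rw [map_const, ← bullet_mul_const, ← bullet_map_mul, ← h, map_const]

theorem IsDElement.inv_mul_map {ι : A →ₐ[k] S} {D : HSDer k A Δ} {r : OneUnits S Δ}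
    (h : IsDElement ι D r) (a : TruncSeries A Δ) :
    ser r⁻¹ * TruncSeries.map (ι : A →+ S) a =
      TruncSeries.map (ι : A →+ S) (tilde (ser D.1⁻¹) a) * ser r⁻¹ := by
  apply ser_mul_left_cancel r
  rw [← mul_assoc, ser_mul_inv, one_mul, ← mul_assoc, h, ← tilde_mul, ser_mul_inv, tilde_one,
    mul_assoc, ser_mul_inv, mul_one]

theorem coeff_map_mul_mem {ι : A →ₐ[k] S} {L : AddSubgroup S}
    (hA : ∀ a : A, ∀ l ∈ L, ι a * l ∈ L) (a : TruncSeries A Δ) {x : TruncSeries S Δ}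
    (hx : ∀ α, coeff α x ∈ L) (α : Fin p →₀ ℕ) :
    coeff α (TruncSeries.map (ι : A →+ S) a * x) ∈ L := by
  by_cases hα : α ∈ Δ.1
  · rw [coeff_mul _ _ hα]
    refine L.sum_mem fun t ht => ?_
    rw [coeff_map _ _ (Coideal.fst_mem hα ht)]
    exact hA _ _ (hx _)
  · rw [coeff_of_notMem hα]
    exact L.zero_mem

/-- This replaces the missing multiplicativity of `φ •`. For `f = c s^β` one has `φ • (r f) = φ(s^β)
(φ • r) c`; the commutation rule moves `φ(s^β)` to the left of `(φ • r)⁻¹`, the units cancel, and a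
scalar series times `c` remains. -/
theorem coeff_inv_mul_bullet_mul_mem {ι : A →ₐ[k] S} {L : AddSubgroup S}
    (hA : ∀ a : A, ∀ l ∈ L, ι a * l ∈ L) {D : HSDer k A Δ} {r : OneUnits S Δ}
    (h : IsDElement ι D r) {f : TruncSeries S Δ} (hf : ∀ α, coeff α f ∈ L) (e : Fin q →₀ ℕ) :
    coeff e (ser (φ.actUnits ι.toRingHom r)⁻¹ * φ.bullet ι.toRingHom (ser r * f)) ∈ L := by
  refine (((isAdic_bullet φ ι.toRingHom).comp (IsAdic.id.mul_left (ser r))).mul_left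
    (ser (φ.actUnits ι.toRingHom r)⁻¹)).coeff_mem (K := L) (fun β c hc e => ?_) hf e
  have h1 : ser r * mono Δ β c =
      TruncSeries.map (ι : A →+ S) (mono Δ β 1) * (ser r * const Δ c) := by
    rw [map_mono, map_one, mono_eq, ← mul_assoc, ← mono_one_mul_comm, mul_assoc]
  have h2 : φ.bullet ι.toRingHom (ser r) = ser (φ.actUnits ι.toRingHom r) := rfl
  rw [h1, bullet_map_mul, bullet_mul_const, h2, ← mul_assoc, (h.actUnits φ).inv_mul_map,
    mul_assoc, ← mul_assoc (ser (φ.actUnits ι.toRingHom r)⁻¹), ser_inv_mul, one_mul]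
  refine coeff_map_mul_mem hA _ (fun α => ?_) e
  by_cases hα : α ∈ Ω.1
  · rw [coeff_const _ hα]
    split_ifs
    · exact hc
    · exact L.zero_mem
  · rw [coeff_of_notMem hα]
    exact L.zero_mem

theorem euler_toAlgHom_mono (α : Fin p →₀ ℕ) :
    euler (φ.toAlgHom (mono Δ α 1)) = ∑ i, euler (φ.toAlgHom (X Δ i)) *
      (α i • φ.toAlgHom (mono Δ (α - Finsupp.single i 1) 1)) := by
  -- When `α i = 0` the truncated subtraction gives a wrong exponent, but the factor `α i` removes
  -- the term.
  have hadd : ∀ α β : Fin p →₀ ℕ, ∀ i : Fin p,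
      α i • (φ.toAlgHom (mono Δ (α - Finsupp.single i 1) 1) * φ.toAlgHom (mono Δ β 1)) =
        α i • φ.toAlgHom (mono Δ (α + β - Finsupp.single i 1) 1) := fun α β i => by
    by_cases h : α i = 0
    · rw [h, zero_smul, zero_smul]
    · rw [← map_mul, mono_mul, one_mul,
        tsub_add_eq_add_tsub (Finsupp.single_le_iff.2 (by omega))]
  have step : ∀ α β : Fin p →₀ ℕ,
      (euler (φ.toAlgHom (mono Δ α 1)) = ∑ i, euler (φ.toAlgHom (X Δ i)) *
        (α i • φ.toAlgHom (mono Δ (α - Finsupp.single i 1) 1))) →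
      (euler (φ.toAlgHom (mono Δ β 1)) = ∑ i, euler (φ.toAlgHom (X Δ i)) *
        (β i • φ.toAlgHom (mono Δ (β - Finsupp.single i 1) 1))) →
      (euler (φ.toAlgHom (mono Δ (α + β) 1)) = ∑ i, euler (φ.toAlgHom (X Δ i)) *
        ((α + β) i • φ.toAlgHom (mono Δ (α + β - Finsupp.single i 1) 1))) := by
    intro α β h1 h2
    have h : mono Δ (α + β) (1 : A) = mono Δ α 1 * mono Δ β 1 := by rw [mono_mul, one_mul]
    rw [h, map_mul, euler_mul, h1, h2, Finset.sum_mul, Finset.mul_sum, ← Finset.sum_add_distrib]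
    refine Finset.sum_congr rfl fun i _ => ?_
    rw [Finsupp.add_apply, add_smul, ← hadd α β i, add_comm α β, ← hadd β α i]
    simp only [nsmul_eq_mul]
    ring
  have h0 : euler (φ.toAlgHom (mono Δ 0 1)) = 0 := by
    have h : mono Δ 0 (1 : A) = 1 := rfl
    rw [h, map_one]
    exact euler_const 1
  induction α using Finsupp.induction_linear with
  | zero => rw [h0]; simp
  | add α β h1 h2 => exact step α β h1 h2
  | single i n =>
    induction n with
    | zero => rw [Finsupp.single_zero, h0]; simp
    | succ n ih =>
      rw [Finsupp.single_add]
      refine step _ _ ih ?_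
      rw [Finset.sum_eq_single i]
      · have h : mono Δ 0 (1 : A) = 1 := rfl
        rw [Finsupp.single_eq_same, one_smul, tsub_self, h, map_one, mul_one]
        rfl
      · intro j _ hj
        rw [Finsupp.single_eq_of_ne hj, zero_smul, mul_zero]
      · intro h
        exact absurd (Finset.mem_univ _) h

end Bullet

/-! ### The chain rule and stability under substitutions of untruncated series. -/

section Top

variable {k A S : Type*} [CommRing k] [CommRing A] [Algebra k A] [Ring S] [Algebra k S]
  {p q : ℕ} {Ω : Coideal q}

/-- The chain rule. -/
theorem euler_bullet (φ : SubstMap A (topCoideal p) Ω) (ι : A →ₐ[k] S)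
    (x : TruncSeries S (topCoideal p)) :
    euler (φ.bullet ι.toRingHom x) = ∑ i, TruncSeries.map (ι : A →+ S)
      (euler (φ.toAlgHom (X _ i))) * φ.bullet ι.toRingHom (partialDeriv i x) := by
  refine IsAdic.ext_mono (IsAdic.euler.comp (isAdic_bullet φ _))
    (IsAdic.sum _ fun i => ((isAdic_bullet φ _).comp (isAdic_partialDeriv i)).mul_left _)
    (fun α c => ?_) x
  rw [bullet_mono, euler_mul, euler_const, mul_zero, add_zero, euler_map, euler_toAlgHom_mono,
    map_sum, Finset.sum_mul]
  refine Finset.sum_congr rfl fun i _ => ?_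
  have hc : const Ω (α i • c) = α i • const Ω c := by
    rw [const, const, map_nsmul, map_nsmul]
  rw [partialDeriv_mono _ _ (mem_topCoideal α), bullet_mono, map_mul', map_nsmul, hc]
  simp only [mul_smul_comm, smul_mul_assoc, mul_assoc]

/-- By the chain rule, `ε(φ • r)` is a sum of terms `(φ • r)⁻¹ χ(φ(s_i)) (φ • ∂_i r)`. The scalar
factor passes to the left, and `∂_i r = r f` with `f = r⁻¹ ∂_i r` having coefficients in `L`. -/
theorem EpsMem.actUnits_of_top {ι : A →ₐ[k] S} {L : AddSubgroup S} (hL : IsLieSubgroup L)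
    (hA : ∀ a : A, ∀ l ∈ L, ι a * l ∈ L) (φ : SubstMap A (topCoideal p) Ω)
    {D : HSDer k A (topCoideal p)} {r : OneUnits S (topCoideal p)} (h : IsDElement ι D r)
    (hr : EpsMem L r) : EpsMem L (φ.actUnits ι.toRingHom r) := by
  intro e
  have h1 : ser (φ.actUnits ι.toRingHom r) = φ.bullet ι.toRingHom (ser r) := rfl
  rw [eps, h1, euler_bullet, Finset.mul_sum, map_sum]
  refine L.sum_mem fun i _ => ?_
  rw [← mul_assoc, (h.actUnits φ).inv_mul_map, mul_assoc]
  refine coeff_map_mul_mem hA _ (fun α => ?_) e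
  have h2 : partialDeriv i (ser r) = ser r * (ser r⁻¹ * partialDeriv i (ser r)) := by
    rw [← mul_assoc, ser_mul_inv, one_mul]
  rw [h2]
  exact coeff_inv_mul_bullet_mul_mem φ hA h (hr.inv_mul_partialDeriv_mem hL i) α

end Top

/-! ### Lifting to untruncated series -/

section Lift

variable {p : ℕ} {Δ : Coideal p}

/-- The truncation `M[[s]] → M[[s]]_Δ`. -/
def truncate {M : Type*} [AddCommGroup M] (Δ : Coideal p) (x : TruncSeries M (topCoideal p)) :
    TruncSeries M Δ :=
  ofFun Δ fun α => coeff α x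

theorem coeff_truncate {M : Type*} [AddCommGroup M] (x : TruncSeries M (topCoideal p))
    {α : Fin p →₀ ℕ} (hα : α ∈ Δ.1) : coeff α (truncate Δ x) = coeff α x :=
  coeff_ofFun hα _

/-- Extension by zero. -/
def extend {M : Type*} [AddCommGroup M] (x : TruncSeries M Δ) : TruncSeries M (topCoideal p) :=
  ofFun _ fun α => coeff α x

theorem coeff_extend {M : Type*} [AddCommGroup M] (x : TruncSeries M Δ) (α : Fin p →₀ ℕ) :
    coeff α (extend x) = coeff α x :=
  coeff_ofFun (mem_topCoideal α) _

theorem truncate_mul {S : Type*} [Ring S] (x y : TruncSeries S (topCoideal p)) :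
    truncate Δ (x * y) = truncate Δ x * truncate Δ y :=
  ext fun α hα => by
    rw [coeff_truncate _ hα, coeff_mul _ _ hα, coeff_mul _ _ (mem_topCoideal α)]
    refine Finset.sum_congr rfl fun t ht => ?_
    rw [coeff_truncate _ (Coideal.fst_mem hα ht), coeff_truncate _ (Coideal.snd_mem hα ht)]

theorem truncate_euler {S : Type*} [Ring S] (x : TruncSeries S (topCoideal p)) :
    truncate Δ (euler x) = euler (truncate Δ x) :=
  ext fun α hα => by
    rw [coeff_truncate _ hα, coeff_euler _ hα, coeff_euler _ (mem_topCoideal α),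
      coeff_truncate _ hα]

theorem truncate_mono {S : Type*} [Ring S] (β : Fin p →₀ ℕ) (c : S) :
    truncate Δ (mono (topCoideal p) β c) = mono Δ β c :=
  ext fun α hα => by
    rw [coeff_truncate _ hα, coeff_mono _ _ hα, coeff_mono _ _ (mem_topCoideal α)]

variable {k A S : Type*} [CommRing k] [CommRing A] [Algebra k A] [Ring S] [Algebra k S]

/-- Truncation as a homomorphism of `A`-algebras. -/
def truncateAlgHom (A : Type*) [CommRing A] (Δ : Coideal p) :
    TruncSeries A (topCoideal p) →ₐ[A] TruncSeries A Δ where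
  toFun := truncate Δ
  map_one' := truncate_mono 0 1
  map_mul' := truncate_mul
  map_zero' := ext fun α hα => by rw [coeff_truncate _ hα, map_zero, map_zero]
  map_add' x y := ext fun α hα => by
    rw [coeff_truncate _ hα, map_add, map_add, coeff_truncate _ hα, coeff_truncate _ hα]
  commutes' := truncate_mono 0

variable {q : ℕ} {Ω : Coideal q}

/-- The substitution map on untruncated series induced by a substitution map. -/
def liftSubst (φ : SubstMap A Δ Ω) : SubstMap A (topCoideal p) Ω where
  toAlgHom := φ.toAlgHom.comp (truncateAlgHom A Δ)
  order_pos i := by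
    show coeff 0 (φ.toAlgHom (truncate Δ (mono (topCoideal p) (Finsupp.single i 1) 1))) = 0
    rw [truncate_mono]
    exact φ.order_pos i

theorem bullet_liftSubst (φ : SubstMap A Δ Ω) (ι : A →+* S)
    (x : TruncSeries S (topCoideal p)) :
    (liftSubst φ).bullet ι x = φ.bullet ι (truncate Δ x) :=
  ext fun e he => by
    rw [SubstMap.coeff_bullet _ _ _ he, SubstMap.coeff_bullet _ _ _ he]
    refine Finset.sum_congr rfl fun α _ => ?_
    have h : (liftSubst φ).toAlgHom (sPow _ α) = φ.toAlgHom (sPow Δ α) :=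
      congrArg φ.toAlgHom (truncate_mono α 1)
    rw [h]
    by_cases hα : α ∈ Δ.1
    · rw [coeff_truncate _ hα]
    · rw [sPow_eq_mono, mono_eq_zero hα, map_zero, map_zero, map_zero, zero_mul, zero_mul]

/-- Truncation is removed by extending `ε(D)` by zero to all exponents and integrating it there. By
uniqueness of the recursion the resulting unit `r'` truncates to `r`, so `φ • r` is the image of
`r'` under the lifted substitution. -/
theorem epsMem_actUnits [Module ℚ S] [Module ℚ (Module.End k A)] {ι : A →ₐ[k] S}
    {N : Derivation k A A →+ S}
    (hN : ∀ (δ : Derivation k A A) (a : A), N δ * ι a = ι a * N δ + ι (δ a))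
    (hL : IsLieSubgroup N.range) (hA : ∀ a : A, ∀ l ∈ N.range, ι a * l ∈ N.range)
    (φ : SubstMap A Δ Ω) {D : HSDer k A Δ} {r : OneUnits S Δ}
    (h : eps r = TruncSeries.map N (epsHS D).1) :
    EpsMem N.range (φ.actUnits ι.toRingHom r) := by
  have h0 : coeff 0 (extend (epsHS D).1) = 0 := by rw [coeff_extend, coeff_zero_epsHS]
  obtain ⟨D', hD'⟩ := epsHS_bijective.2
    (⟨extend (epsHS D).1, h0⟩ : plus (Derivation k A A) (topCoideal p))
  obtain ⟨r', hr'⟩ := exists_eps_eq (TruncSeries.map N (extend (epsHS D).1))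
    (by rw [coeff_map _ _ (mem_topCoideal 0), h0, map_zero])
  have hmem : EpsMem N.range r' := fun α => by
    rw [hr', coeff_map _ _ (mem_topCoideal α)]
    exact ⟨_, rfl⟩
  have htr : truncate Δ (ser r') = ser r := by
    refine eq_of_euler_eq (coeff_zero_eps r) ?_ ?_ (series_mul_eps r).symm
    · rw [coeff_truncate _ Δ.zero_mem, coeff_zero_ser, coeff_zero_ser]
    · rw [← truncate_euler, ← series_mul_eps, truncate_mul, hr', h]
      congr 1
      refine ext fun α hα => ?_
      rw [coeff_truncate _ hα, coeff_map _ _ hα, coeff_map _ _ (mem_topCoideal α), coeff_extend]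
  have hact : φ.actUnits ι.toRingHom r = (liftSubst φ).actUnits ι.toRingHom r' := by
    refine ser_injective ?_
    show φ.bullet ι.toRingHom (ser r) = (liftSubst φ).bullet ι.toRingHom (ser r')
    rw [bullet_liftSubst, htr]
  rw [hact]
  exact hmem.actUnits_of_top hL hA _ (isDElement_of_eps_eq (D := D') hN (by rw [hr', hD']))

end Lift

/-! ### Pairs of units -/

theorem sum_prodMk {I S T : Type*} [AddCommMonoid S] [AddCommMonoid T] (s : Finset I)
    (f : I → S) (g : I → T) : ∑ i ∈ s, (f i, g i) = (∑ i ∈ s, f i, ∑ i ∈ s, g i) :=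
  Prod.ext Prod.fst_sum Prod.snd_sum

section Pair

variable {S T : Type*} [Ring S] [Ring T] {p : ℕ} {Δ : Coideal p}

/-- The series with coefficients the pairs of coefficients of `x` and `y`. -/
def pairSeries (x : TruncSeries S Δ) (y : TruncSeries T Δ) :
    @TruncSeries (S × T) Ring.toAddCommGroup p Δ :=
  ofFun Δ fun α => (coeff α x, coeff α y)

theorem coeff_pairSeries (x : TruncSeries S Δ) (y : TruncSeries T Δ) {α : Fin p →₀ ℕ}
    (hα : α ∈ Δ.1) : coeff α (pairSeries x y) = (coeff α x, coeff α y) :=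
  coeff_ofFun hα _

theorem pairSeries_mul (x x' : TruncSeries S Δ) (y y' : TruncSeries T Δ) :
    pairSeries x y * pairSeries x' y' = pairSeries (x * x') (y * y') :=
  ext fun α hα => by
    rw [coeff_mul _ _ hα, coeff_pairSeries _ _ hα, coeff_mul _ _ hα, coeff_mul _ _ hα,
      ← sum_prodMk]
    refine Finset.sum_congr rfl fun q hq => ?_
    rw [coeff_pairSeries _ _ (Coideal.fst_mem hα hq), coeff_pairSeries _ _ (Coideal.snd_mem hα hq)]
    rfl

theorem euler_pairSeries (x : TruncSeries S Δ) (y : TruncSeries T Δ) :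
    euler (pairSeries x y) = pairSeries (euler x) (euler y) :=
  ext fun α hα => by
    rw [coeff_euler _ hα, coeff_pairSeries _ _ hα, coeff_pairSeries _ _ hα, coeff_euler _ hα,
      coeff_euler _ hα]
    rfl

/-- The element of `U^p(S × T; Δ)` with given components. -/
def pairUnit (r : OneUnits S Δ) (t : OneUnits T Δ) : OneUnits (S × T) Δ :=
  ofSer (pairSeries (ser r) (ser t)) (by
    rw [coeff_pairSeries _ _ Δ.zero_mem, coeff_zero_ser, coeff_zero_ser]
    rfl)

theorem ser_pairUnit (r : OneUnits S Δ) (t : OneUnits T Δ) :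
    ser (pairUnit r t) = pairSeries (ser r) (ser t) := rfl

theorem pairUnit_mul (r r' : OneUnits S Δ) (t t' : OneUnits T Δ) :
    pairUnit r t * pairUnit r' t' = pairUnit (r * r') (t * t') :=
  ser_injective (pairSeries_mul _ _ _ _)

theorem eps_pairUnit (r : OneUnits S Δ) (t : OneUnits T Δ) :
    eps (pairUnit r t) = pairSeries (eps r) (eps t) :=
  eps_eq_of_mul_eq _ (by
    rw [ser_pairUnit, pairSeries_mul, series_mul_eps, series_mul_eps, euler_pairSeries])

end Pair

/-! ### The HS-structure attached to an LR-admissible map -/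

section Integrate

variable {k A R : Type*} [CommRing k] [CommRing A] [Algebra k A] [Ring R]
  {p : ℕ} {Δ : Coideal p}

theorem eps_pairUnit_of_eps_eq {nabla : Derivation k A A →+ R} {D : HSDer k A Δ}
    {r : OneUnits R Δ} (h : eps r = TruncSeries.map nabla (epsHS D).1) :
    eps (pairUnit D.1 r) = TruncSeries.map ((derivToEnd k A).prod nabla) (epsHS D).1 := by
  rw [eps_pairUnit, h, ← map_derivToEnd_epsHS]
  refine ext fun α hα => ?_
  rw [coeff_pairSeries _ _ hα, coeff_map _ _ hα, coeff_map _ _ hα]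
  exact (coeff_map ((derivToEnd k A).prod nabla) (epsHS D).1 hα).symm

theorem epsMem_pairUnit {nabla : Derivation k A A →+ R} {D : HSDer k A Δ}
    {r : OneUnits R Δ} (h : eps r = TruncSeries.map nabla (epsHS D).1) :
    EpsMem ((derivToEnd k A).prod nabla).range (pairUnit D.1 r) := fun α => by
  rw [eps_pairUnit_of_eps_eq h]
  by_cases hα : α ∈ Δ.1
  · exact ⟨coeff α (epsHS D).1, (coeff_map _ _ hα).symm⟩
  · exact ⟨0, by rw [map_zero]; exact (coeff_of_notMem hα _).symm⟩

/-- The range is the graph of `∇`: the first component of an element determines the derivation,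
hence the second component. -/
theorem eps_eq_of_epsMem_pairUnit {nabla : Derivation k A A →+ R} {D : HSDer k A Δ}
    {r : OneUnits R Δ} (h : EpsMem ((derivToEnd k A).prod nabla).range (pairUnit D.1 r)) :
    eps r = TruncSeries.map nabla (epsHS D).1 := by
  refine ext fun α hα => ?_
  obtain ⟨δ, hδ⟩ := h α
  rw [eps_pairUnit, coeff_pairSeries _ _ hα] at hδ
  have h1 : derivToEnd k A δ = coeff α (eps D.1) := congrArg Prod.fst hδ
  have h2 : nabla δ = coeff α (eps r) := congrArg Prod.snd hδ
  rw [← map_derivToEnd_epsHS, coeff_map _ _ hα] at h1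
  rw [coeff_map _ _ hα, ← h2, derivToEnd_injective h1]

/-- The unit `r` with `ε(r) = ∇̄(ε(D))`. -/
def integrate [Module ℚ R] (nabla : Derivation k A A →+ R) (D : HSDer k A Δ) : OneUnits R Δ :=
  (epsPlus_bijective.2 (mapPlus nabla (epsHS D))).choose

theorem epsPlus_integrate [Module ℚ R] (nabla : Derivation k A A →+ R) (D : HSDer k A Δ) :
    epsPlus (integrate nabla D) = mapPlus nabla (epsHS D) :=
  (epsPlus_bijective.2 (mapPlus nabla (epsHS D))).choose_spec

theorem eps_integrate [Module ℚ R] (nabla : Derivation k A A →+ R) (D : HSDer k A Δ) :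
    eps (integrate nabla D) = TruncSeries.map nabla (epsHS D).1 :=
  congrArg Subtype.val (epsPlus_integrate nabla D)

theorem eq_integrate [Module ℚ R] {nabla : Derivation k A A →+ R} {D : HSDer k A Δ}
    {r : OneUnits R Δ} (h : eps r = TruncSeries.map nabla (epsHS D).1) :
    r = integrate nabla D :=
  eps_injective (h.trans (eps_integrate nabla D).symm)

end Integrate

section Structure

variable {k A R : Type*} [CommRing k] [CommRing A] [Algebra k A] [Ring R] [Algebra k R]
  {p : ℕ} {Δ : Coideal p}

theorem IsLRAdmissible.isLieSubgroup_range [Module ℚ (Derivation k A A)] [Module ℚ R]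
    {ι : A →ₐ[k] R} {nabla : Derivation k A A →+ R} (h : IsLRAdmissible ι nabla) :
    IsLieSubgroup nabla.range where
  div n hn x := by
    rintro ⟨δ, hδ⟩
    refine ⟨(n : ℚ)⁻¹ • δ, eq_of_nsmul_eq hn ?_⟩
    rw [← map_nsmul, nsmul_inv_smul hn, hδ]
  bracket := by
    rintro _ ⟨δ, rfl⟩ _ ⟨δ', rfl⟩
    exact ⟨⁅δ, δ'⁆, h.map_bracket δ δ'⟩

theorem IsLRAdmissible.map_mul_mem_range {ι : A →ₐ[k] R} {nabla : Derivation k A A →+ R}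
    (h : IsLRAdmissible ι nabla) (a : A) (l : R) (hl : l ∈ nabla.range) :
    ι a * l ∈ nabla.range := by
  obtain ⟨δ, rfl⟩ := hl
  exact ⟨a • δ, h.map_smul a δ⟩

theorem IsLRAdmissible.prod {S : Type*} [Ring S] [Algebra k S] {ι : A →ₐ[k] R}
    {nabla : Derivation k A A →+ R} (h : IsLRAdmissible ι nabla) {κ : A →ₐ[k] S}
    {N : Derivation k A A →+ S} (h' : IsLRAdmissible κ N) :
    IsLRAdmissible (κ.prod ι) (N.prod nabla) where
  map_smul a δ := Prod.ext (h'.map_smul a δ) (h.map_smul a δ)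
  leibniz δ a := Prod.ext (h'.leibniz δ a) (h.leibniz δ a)
  map_bracket δ δ' := Prod.ext (h'.map_bracket δ δ') (h.map_bracket δ δ')

theorem actUnits_pairUnit (ι : A →ₐ[k] R) {q : ℕ} {Ω : Coideal q} (φ : SubstMap A Δ Ω)
    (D : HSDer k A Δ) (r : OneUnits R Δ) :
    φ.actUnits ((Algebra.lmul k A).prod ι).toRingHom (pairUnit D.1 r) =
      pairUnit (φ.actHS D).1 (φ.actUnits ι.toRingHom r) := by
  refine ser_injective ?_
  show φ.bullet _ (pairSeries (ser D.1) (ser r)) =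
    pairSeries (φ.bullet (Algebra.lmul k A).toRingHom (ser D.1)) (φ.bullet ι.toRingHom (ser r))
  refine ext fun e he => ?_
  rw [φ.coeff_bullet _ _ he, coeff_pairSeries _ _ he, φ.coeff_bullet _ _ he,
    φ.coeff_bullet _ _ he, ← sum_prodMk]
  refine Finset.sum_congr rfl fun α _ => ?_
  by_cases hα : α ∈ Δ.1
  · rw [coeff_pairSeries _ _ hα]
    rfl
  · rw [coeff_of_notMem hα, coeff_of_notMem hα, coeff_of_notMem hα, mul_zero, mul_zero, mul_zero]
    rfl

theorem HSStructure.ext_psi {ι : A →ₐ[k] R} {Ψ Ψ' : HSStructure ι}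
    (h : ∀ p Δ D, Ψ.Psi p Δ D = Ψ'.Psi p Δ D) : Ψ = Ψ' := by
  obtain ⟨f, _, _⟩ := Ψ
  obtain ⟨g, _, _⟩ := Ψ'
  have : f = g := funext fun p => funext fun Δ => MonoidHom.ext (h p Δ)
  subst this
  rfl

variable [Module ℚ R] [Module ℚ (Module.End k A)] [Module ℚ (Derivation k A A)]

/-- The product of the pairs `(D, Ψ(D))` and `(E, Ψ(E))` still has logarithmic derivative in the
graph of `∇`, so its second component is `Ψ(DE)`. -/
theorem integrate_mul {ι : A →ₐ[k] R} {nabla : Derivation k A A →+ R}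
    (h : IsLRAdmissible ι nabla) (D E : HSDer k A Δ) :
    integrate nabla (D * E) = integrate nabla D * integrate nabla E := by
  symm
  refine eq_integrate (eps_eq_of_epsMem_pairUnit ?_)
  have := (epsMem_pairUnit (eps_integrate nabla D)).mul
    (h.prod (isLRAdmissible_derivToEnd k A)).isLieSubgroup_range
    (epsMem_pairUnit (eps_integrate nabla E))
  rwa [pairUnit_mul] at this

theorem integrate_actHS {ι : A →ₐ[k] R} {nabla : Derivation k A A →+ R}
    (h : IsLRAdmissible ι nabla) {q : ℕ} {Ω : Coideal q} (φ : SubstMap A Δ Ω)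
    (D : HSDer k A Δ) :
    integrate nabla (φ.actHS D) = φ.actUnits ι.toRingHom (integrate nabla D) := by
  symm
  refine eq_integrate (eps_eq_of_epsMem_pairUnit ?_)
  have h' := h.prod (isLRAdmissible_derivToEnd k A)
  rw [← actUnits_pairUnit]
  exact epsMem_actUnits h'.leibniz h'.isLieSubgroup_range h'.map_mul_mem_range φ
    (eps_pairUnit_of_eps_eq (eps_integrate nabla D))

/-- The HS-structure attached to an LR-admissible map. -/
def IsLRAdmissible.hsStructure {ι : A →ₐ[k] R} {nabla : Derivation k A A →+ R}
    (h : IsLRAdmissible ι nabla) : HSStructure ι where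
  Psi _ _ := MonoidHom.mk' (integrate nabla) (integrate_mul h)
  leibniz _ _ D := isDElement_of_eps_eq h.leibniz (eps_integrate nabla D)
  subst _ _ _ _ φ D := integrate_actHS h φ D

/-- Compatibility with `∇` is required only for `p ≥ 1`; for `p = 0` uniqueness holds because the
target group is trivial. -/
theorem oneUnits_eq_of_isEmpty {S : Type*} [Ring S] {Δ : Coideal 0} (r r' : OneUnits S Δ) :
    r = r' :=
  ser_injective (ext fun α _ => by
    rw [Subsingleton.elim α 0, coeff_zero_ser, coeff_zero_ser])

theorem IsLRAdmissible.existsUnique_hsStructure {ι : A →ₐ[k] R} {nabla : Derivation k A A →+ R}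
    (h : IsLRAdmissible ι nabla) : ∃! Ψ : HSStructure ι, Ψ.IsCompatible nabla := by
  refine ⟨h.hsStructure, fun p _ Δ D => epsPlus_integrate nabla D, fun Ψ hΨ => ?_⟩
  refine HSStructure.ext_psi fun p Δ D => ?_
  rcases Nat.eq_zero_or_pos p with rfl | hp
  · exact oneUnits_eq_of_isEmpty _ _
  · exact eq_integrate (congrArg Subtype.val (hΨ p hp Δ D))

end Structure

/-! ### Filtrations -/

section Filtration

variable {k A R : Type*} [CommRing k] [CommRing A] [Algebra k A] [Ring R] [Algebra k R]
  {p : ℕ} {Δ : Coideal p}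

/-- The pieces `F d` are only assumed to be additive subgroups; division by `n` is multiplication by
the image of `1/n ∈ A`, which lies in `F 0`. -/
theorem IsAlgFiltration.mem_of_nsmul_mem [Algebra ℚ k] {ι : A →ₐ[k] R} {F : ℕ → AddSubgroup R}
    (hF : IsAlgFiltration ι F) {n d : ℕ} (hn : n ≠ 0) {x : R} (hx : n • x ∈ F d) : x ∈ F d := by
  have h : ι (algebraMap k A (algebraMap ℚ k (n : ℚ)⁻¹)) * n • x = x := by
    rw [ι.commutes, nsmul_eq_mul, ← mul_assoc, ← map_natCast (algebraMap k R) n,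
      ← map_natCast (algebraMap ℚ k) n, ← map_mul, ← map_mul,
      inv_mul_cancel₀ (by exact_mod_cast hn), map_one, map_one, one_mul]
  rw [← h, ← zero_add d]
  exact hF.mul_mem 0 d _ _ (hF.range_le _) hx

theorem mem_filUnits_of_eps_mem [Algebra ℚ k] {ι : A →ₐ[k] R} {F : ℕ → AddSubgroup R}
    (hF : IsAlgFiltration ι F) {r : OneUnits R Δ} (hr : ∀ α, coeff α (eps r) ∈ F 1) :
    r ∈ filUnits F Δ := by
  have key : ∀ n : ℕ, ∀ α ∈ Δ.1, α.degree = n → coeff α (ser r) ∈ F α.degree := by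
    intro n
    induction n using Nat.strong_induction_on with
    | _ n ih =>
      intro α hα hn
      by_cases hα0 : α = 0
      · rw [hα0, coeff_zero_ser, map_zero]
        exact hF.one_mem
      refine hF.mem_of_nsmul_mem (degree_pos_of_ne hα0).ne' ?_
      rw [← coeff_euler _ hα, ← series_mul_eps, coeff_mul _ _ hα]
      refine (F α.degree).sum_mem fun q hq => ?_
      by_cases h2 : q.2 = 0
      · rw [h2, coeff_zero_eps, mul_zero]
        exact (F _).zero_mem
      · have hlt := degree_fst_lt hq h2
        -- The product lies in `F (|q.1| + 1)`, and `|q.1| < |α|` is the same as `|q.1| + 1 ≤ |α|`.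
        exact hF.mono hlt (hF.mul_mem _ 1 _ _
          (ih _ (hn ▸ hlt) _ (Coideal.fst_mem hα hq) rfl) (hr _))
  exact fun α hα => key _ α hα rfl

theorem HSStructure.IsCompatible.isFiltered [Algebra ℚ k] {ι : A →ₐ[k] R} {Ψ : HSStructure ι}
    {nabla : Derivation k A A →+ R} (hΨ : Ψ.IsCompatible nabla) {F : ℕ → AddSubgroup R}
    (hF : IsAlgFiltration ι F) (hnabla : ∀ δ, nabla δ ∈ F 1) : Ψ.IsFiltered F := by
  intro p Δ D
  rcases Nat.eq_zero_or_pos p with rfl | hp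
  · intro α _
    rw [Subsingleton.elim α 0, coeff_zero_ser, map_zero]
    exact hF.one_mem
  · refine mem_filUnits_of_eps_mem hF fun α => ?_
    have h : eps (Ψ.Psi p Δ D) = TruncSeries.map nabla (epsHS D).1 :=
      congrArg Subtype.val (hΨ p hp Δ D)
    rw [h]
    by_cases hα : α ∈ Δ.1
    · rw [coeff_map _ _ hα]
      exact hnabla _
    · rw [coeff_of_notMem hα]
      exact (F 1).zero_mem

end Filtration

end

end HasseSchmidt

theorem mainTheorem1 {k A R : Type*} [CommRing k] [Algebra ℚ k] [CommRing A] [Algebra k A]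
    [Ring R] [Algebra k R] (ι : A →ₐ[k] R) (nabla : Derivation k A A →+ R)
    (hnabla : HasseSchmidt.IsLRAdmissible ι nabla) :
    (∃! Ψ : HasseSchmidt.HSStructure ι, Ψ.IsCompatible nabla) ∧
    (∀ Ψ : HasseSchmidt.HSStructure ι, Ψ.IsCompatible nabla →
      ∀ F : ℕ → AddSubgroup R, HasseSchmidt.IsAlgFiltration ι F →
        (∀ δ : Derivation k A A, nabla δ ∈ F 1) → Ψ.IsFiltered F) ∧
    (∀ p : ℕ, 1 ≤ p → ∀ Δ : HasseSchmidt.Coideal p,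
      Function.Bijective
        (HasseSchmidt.epsHS : HasseSchmidt.HSDer k A Δ →
          HasseSchmidt.TruncSeries.plus (Derivation k A A) Δ) ∧
      Function.Bijective
        (HasseSchmidt.epsPlus : HasseSchmidt.OneUnits R Δ →
          HasseSchmidt.TruncSeries.plus R Δ)) := by
  -- The three rational structures used for division are obtained by restricting scalars along `ℚ →
  -- k`.
  let _ : Module ℚ R := Module.compHom R (algebraMap ℚ k)
  let _ : Module ℚ (Module.End k A) := Module.compHom (Module.End k A) (algebraMap ℚ k)
  let _ : Module ℚ (Derivation k A A) := Module.compHom (Derivation k A A) (algebraMap ℚ k)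
  exact ⟨hnabla.existsUnique_hsStructure, fun Ψ hΨ F hF hN => hΨ.isFiltered hF hN,
    fun p _ Δ => ⟨HasseSchmidt.epsHS_bijective, HasseSchmidt.epsPlus_bijective⟩⟩
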